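/- Let $K$ be a field containing $\mathbb{C}$ and let $u,t,s\in K^{\times}$ (for instance three independent variables; every matrix coefficient below is, in each degree in $x$, a Laurent polynomial in $u,t,s$, so the identity is one in $\mathrm{End}(\mathcal F)[[u^{\pm1},t^{\pm1},s^{\pm1}]]$ for each power of $x$). Notation. $V$ has basis $z^k$, $k\in\mathbb{Z}+\frac12$, completed to $z^{1/2}K((z))$; $\mathcal F=\Lambda^{\infty/2}V$ has the orthonormal basis $v_S=z^{s_1}\wedge z^{s_2}\wedge\cdots$, where $S=\{s_1>s_2>\cdots\}\subset\mathbb{Z}+\frac12$ has finitely many positive elements (the set $S_+$) and misses finitely many negative half-integers (the set $S_-$). $\psi_k=z^k\wedge$, $\psi_k^*$ is its adjoint, $:\!\psi_i\psi_j^*\!:\;=\psi_i\psi_j^*$ for $j>0$ and $-\psi_j^*\psi_i$ for $j<0$, $\pi(A)=\sum A_{ij}:\!\psi_i\psi_j^*\!:$, and $C v_S=(|S_+|-|S_-|)v_S$ is the charge. On $V$, $\alpha_n$ is multiplication by $z^{-n}$ and $H=z\frac{d}{dz}$; on $\mathcal F$, $\alpha_n$ stands for $\pi(\alpha_n)$.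 Let $$\mathrm D=\frac{\alpha_1}{s}-\sum_{n>0}\Big(\frac{t}{iu}\Big)^n\,\frac{H\alpha_{-n}+\alpha_{-n}H}{2}$$ on $V$. The symbols $\sigma_k(z)=z^{-k}\,e^{xs\mathrm D}z^k\in K((z))[[x]]$ $(k\in\mathbb{Z}+\frac12)$ satisfy $\sigma_{k-1}=r\,\sigma_k$ for some $r\ne1$ independent of $k$. As an operator on $\mathcal F$, $e^{xs\mathrm D}$ means $\sum_{i,j}(e^{xs\mathrm D})_{ij}\,\psi_i\psi_j^*$ with regularised vacuum expectation, i.e. $$\pi(e^{xs\mathrm D})+[z^0]\sum_{k<0}\sigma_k(z),\qquad \sum_{k<0}\sigma_k:=\frac{\sigma_{-1/2}}{1-r},$$ a formal Laurent series in $x$. Statement. There is a unique formal power series $w=y+O(x)$ in $x$, with coefficients in $K((y^{-1}))$, on the curve $$y\,e^{-iuy/t}=w\,e^{-iuw/t}e^{sx},$$ and $dw/dy$ has a unique square root $\sqrt{dw/dy}=1+O(x)$. With $\sqrt{dy\,dw}=\sqrt{dw/dy}\,dy$ one has, as operators on $\mathcal F$ (equality of all matrix coefficients between basis vectors $v_S,v_T$,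 as Laurent series in $x$), $$e^{xs\mathrm D}=\oint_{|y|=1/\epsilon}\frac{\sqrt{dy\,dw}}{y-w}\,\exp\Big(\frac{iu}{2st}(w^2-y^2)+\frac1s(y-w)\Big)\Big(\frac yw\Big)^{C}:\exp\Big(\sum_{n\neq0}\frac{\alpha_n}{n}\big(w^{-n}-y^{-n}\big)\Big):$$ where $\oint_{|y|=1/\epsilon}f\,dy$ is the coefficient of $y^{-1}$ of the expansion of $f$ at $y=\infty$, and normal ordering puts the $\alpha_n$ with $n<0$ to the left of those with $n>0$. On the charge $0$ subspace the factor $(y/w)^C$ is $1$. -/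

import Mathlib

noncomputable section

namespace BosonFermion

/-! ### Fermionic Fock space

The half-integer `n + 1/2` is represented by the integer `n` throughout, so that positive
half-integers correspond to `0 ≤ n` and negative ones to `n < 0`. -/

/-- The subsets `S` of `ℤ + 1/2` with `S₊` (its positive elements) and `S₋` (the negative
half-integers missing from it) finite. -/
def Maya : Type :=
  {S : Set ℤ // (S ∩ Set.Ici 0).Finite ∧ (Set.Iio 0 \ S).Finite}

/-- `S ∪ {k}`. -/
def Maya.insert (S : Maya) (k : ℤ) : Maya :=
  ⟨Insert.insert k S.1,
    (S.2.1.insert k).subset (by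
      rintro x ⟨hx | hx, h0⟩
      · exact Or.inl hx
      · exact Or.inr ⟨hx, h0⟩),
    S.2.2.subset (fun _ hx => ⟨hx.1, fun h => hx.2 (Or.inr h)⟩)⟩

/-- `S ∖ {k}`. -/
def Maya.erase (S : Maya) (k : ℤ) : Maya :=
  ⟨S.1 \ {k},
    S.2.1.subset (fun _ hx => ⟨hx.1.1, hx.2⟩),
    (S.2.2.insert k).subset (by
      rintro x ⟨h0, hx⟩
      by_cases h : x = k
      · exact Or.inl h
      · exact Or.inr ⟨h0, fun hS => hx ⟨hS, h⟩⟩)⟩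

/-- The charge `|S₊| - |S₋|`. -/
def Maya.charge (S : Maya) : ℤ :=
  ((S.1 ∩ Set.Ici 0).ncard : ℤ) - ((Set.Iio 0 \ S.1).ncard : ℤ)

/-- The sign of moving `z^k` past the elements of `S` that are larger than `k`. -/
def Maya.sign (S : Maya) (k : ℤ) : ℤ := (-1) ^ (S.1 ∩ Set.Ioi k).ncard

/-- The Fock space `Λ^{∞/2} V`, with basis `v_S`. -/
abbrev Fock (K : Type*) [Field K] : Type _ := Maya →₀ K

section Operators

variable (K : Type*) [Field K]

/-- The basis vector `v_S = z^{s₁} ∧ z^{s₂} ∧ ⋯`, `S = {s₁ > s₂ > ⋯}`. -/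
def vec (S : Maya) : Fock K := Finsupp.single S 1

open Classical in
/-- `ψ_k v = z^k ∧ v`. -/
def psi (k : ℤ) : Module.End K (Fock K) :=
  Finsupp.linearCombination K fun S : Maya =>
    if k ∈ S.1 then 0 else (S.sign k : K) • vec K (S.insert k)

open Classical in
/-- `ψ_k^*`, the adjoint of `ψ_k` for the inner product in which the `v_S` are orthonormal. -/
def psiStar (k : ℤ) : Module.End K (Fock K) :=
  Finsupp.linearCombination K fun S : Maya =>
    if k ∈ S.1 then (S.sign k : K) • vec K (S.erase k) else 0

/-- The normally ordered product `:ψ_i ψ_j^*:`, that is `π(E_{ij})`. -/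
def normalPair (i j : ℤ) : Module.End K (Fock K) :=
  if 0 ≤ j then psi K i * psiStar K j else -(psiStar K j * psi K i)

/-- The matrix coefficient between `v_S` and `v_T` of `π(A) = ∑ A_{ij} :ψ_i ψ_j^*:`; for every
matrix `A` only finitely many terms are nonzero. -/
def piCoeff (A : ℤ → ℤ → K) (T S : Maya) : K :=
  ∑ᶠ p : ℤ × ℤ, A p.1 p.2 * (normalPair K p.1 p.2 (vec K S)) T

/-- The Heisenberg operator `α_n = π(∑_k E_{k-n,k})` on the Fock space. -/
def alpha (n : ℤ) : Module.End K (Fock K) :=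
  Finsupp.linearCombination K fun S : Maya => ∑ᶠ k : ℤ, normalPair K (k - n) k (vec K S)

/-- The normally ordered monomial `:α_{n₁} ⋯ α_{n_p}:`: the factors are rearranged with increasing
index, so that the `α_n` with `n < 0` stand to the left of those with `n > 0`. -/
def normalMonomial (l : List {n : ℤ // n ≠ 0}) : Module.End K (Fock K) :=
  (((l.map Subtype.val).insertionSort (· ≤ ·)).map (alpha K)).prod

/-! ### Formal series

`V = z^{1/2} K((z))`, where the element `z^{1/2} f` is represented by `f`, so `z^{n+1/2}` by
`single n 1`. Functions of `y` expanded on a large circle `|y| = 1/ε` are Laurent series in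
`y⁻¹`; we use `z` for the letter `y⁻¹`, so `y = z⁻¹`. -/

/-- Formal Laurent series in `z = y⁻¹`: finitely many positive powers of `y`. -/
abbrev Ser : Type _ := LaurentSeries K

/-- Formal power series in `x` whose coefficients are Laurent series in `z = y⁻¹`. -/
abbrev SerX : Type _ := PowerSeries (Ser K)

/-- Formal Laurent series in `x` whose coefficients are Laurent series in `z = y⁻¹`. -/
abbrev LSerX : Type _ := LaurentSeries (Ser K)

variable {K}

/-- The coefficient of `z^k`, as a Laurent series in `x`. -/
def coeffZ (k : ℤ) (f : LSerX K) : LaurentSeries K :=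
  f.map (HahnSeries.coeff.addMonoidHom k : Ser K →+ K)

/-- `(1/2πi) ∮ f dy` over the circle `|y| = 1/ε`: the coefficient of `y⁻¹` in the expansion at
`y = ∞`. -/
def contour (f : LSerX K) : LaurentSeries K := coeffZ 1 f

/-- The variable `y = z⁻¹`. -/
def yVar : Ser K := HahnSeries.single (-1) 1

/-- `d/dy = -z² d/dz` on Laurent series in `z = y⁻¹`, applied to each coefficient of a power series
in `x`. -/
def derivY (f : SerX K) : SerX K :=
  PowerSeries.mk fun m =>
    -(HahnSeries.single 2 1 * LaurentSeries.derivative K (PowerSeries.coeff m f))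

/-- The exponential of a power series in `x` without constant term. -/
def expX (f : SerX K) : SerX K :=
  (PowerSeries.mk fun n => ((n.factorial : Ser K))⁻¹ : SerX K).subst f

/-- A constant, as a power series in `x`. -/
def cst (a : K) : SerX K := PowerSeries.C (HahnSeries.C a)

/-- The matrix coefficient between `v_S` and `v_T` of
`:exp(∑_{n ≠ 0} a_n α_n): = ∑_p (1/p!) ∑_{n₁, …, n_p ≠ 0} a_{n₁} ⋯ a_{n_p} :α_{n₁} ⋯ α_{n_p}:`,
in which only finitely many terms are nonzero. -/
def normalExpCoeff (a : ℤ → LSerX K) (T S : Maya) : LSerX K :=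
  ∑ᶠ l : List {n : ℤ // n ≠ 0},
    (l.length.factorial : LSerX K)⁻¹ * (l.map fun n => a n.1).prod *
      HahnSeries.C (HahnSeries.C ((normalMonomial K l (vec K S)) T))

/-! ### Exponentials of operators on `V` and their action on the Fock space -/

/-- Multiplication by `f`, as an operator on `V`. -/
def mulOp (f : Ser K) : Module.End K (Ser K) where
  toFun g := f * g
  map_add' := mul_add f
  map_smul' a g := by
    simp only [RingHom.id_apply, ← HahnSeries.C_mul_eq_smul]
    ring

/-- `H = z d/dz` on `z^{1/2} K((z))`. -/
def opH : Module.End K (Ser K) :=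
  mulOp (HahnSeries.single 1 1) * LaurentSeries.derivative K +
    (2 : K)⁻¹ • 1

/-- The entry `(i, j)` of the matrix of an operator on `V`. -/
def entry (B : Module.End K (Ser K)) (i j : ℤ) : K :=
  (B (HahnSeries.single j 1)).coeff i

/-- The symbol `z^{-k} · e^{xB} z^k` of `e^{xB}`, where `k = n + 1/2`. -/
def symbol (B : Module.End K (Ser K)) (n : ℤ) : SerX K :=
  PowerSeries.mk fun m =>
    (m.factorial : K)⁻¹ • (HahnSeries.single (-n) 1 * (B ^ m) (HahnSeries.single n 1))

/-- The regularised vacuum expectation `∑_{k < 0} (e^{xB})_{kk}` of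
`∑ (e^{xB})_{ij} ψ_i ψ_j^*`, for an operator whose symbols form a geometric progression: the series
`∑_{k < 0} z^{-k} e^{xB} z^k` is summed as a geometric series, with first term `k = -1/2`, and
`(e^{xB})_{kk}` is the coefficient of `z^0`. For `B = s H` this is
`∑_{k < 0} e^{sxk} = 1 / (e^{sx/2} - e^{-sx/2})`. -/
def vacuumTerm (B : Module.End K (Ser K)) : LaurentSeries K :=
  coeffZ 0 ((symbol B (-1) : LSerX K) *
    (1 - (symbol B (-2) : LSerX K) / (symbol B (-1) : LSerX K))⁻¹)

open Classical in
/-- The matrix coefficient between `v_S` and `v_T` of the operator on the Fock space given by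
`e^{xB}`, that is `∑ (e^{xB})_{ij} ψ_i ψ_j^*`: the sum of `π(e^{xB})` and of the regularised vacuum
expectation. -/
def expCoeff (B : Module.End K (Ser K)) (T S : Maya) : LaurentSeries K :=
  ((PowerSeries.mk fun m =>
      piCoeff K (fun i j => (m.factorial : K)⁻¹ * entry (B ^ m) i j) T S : PowerSeries K) :
      LaurentSeries K) +
    if T = S then vacuumTerm B else 0

/-! ### The dressed operator and the curve -/

variable [Algebra ℂ K]

/-- The imaginary unit in `K`. -/
def imag : K := algebraMap ℂ K Complex.I

/-- Multiplication by `z^{-n}`, the operator `α_n` on `V`. -/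
def alphaV (n : ℤ) : Module.End K (Ser K) :=
  mulOp (HahnSeries.single (-n) 1)

/-- The operator `∑_{n > 0} (t/iu)^n α_{-n}` on `V`: multiplication by `∑_{n > 0} (t/iu)^n z^n`. -/
def alphaSum (u t : K) : Module.End K (Ser K) :=
  mulOp
    ((PowerSeries.mk fun n => if n = 0 then 0 else (t / (imag * u)) ^ n : PowerSeries K) : Ser K)

/-- The dressed operator
`D = α_1 / s - ∑_{n > 0} (t/iu)^n (H α_{-n} + α_{-n} H) / 2` on `V`. -/
def opD (u t s : K) : Module.End K (Ser K) :=
  s⁻¹ • alphaV 1 - (2 : K)⁻¹ • (opH * alphaSum u t + alphaSum u t * opH)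

/-- `w = y + O(x)` satisfies `y e^{-iuy/t} = w e^{-iuw/t} e^{sx}`, after division by
`e^{-iuy/t}`. -/
def OnCurve (u t s : K) (w : SerX K) : Prop :=
  PowerSeries.constantCoeff w = yVar ∧
    PowerSeries.C yVar =
      w * expX (cst (imag * u / t) * (PowerSeries.C yVar - w) + cst s * PowerSeries.X)

/-- `√(dw/dy)`, in the branch that is `1` at `x = 0`. -/
def IsSqrtDeriv (w ρ : SerX K) : Prop :=
  PowerSeries.constantCoeff ρ = 1 ∧ ρ ^ 2 = derivY w

/-- The coefficient between `v_S` and `v_T` of the integrand (with `√(dy dw) = ρ dy`)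
`ρ / (y - w) · exp((iu/2st)(w² - y²) + (y - w)/s) · (y/w)^C ·
  :exp(∑_{n ≠ 0} (α_n/n)(w^{-n} - y^{-n})):`. -/
def integrand (u t s : K) (w ρ : SerX K) (T S : Maya) : LSerX K :=
  let y : SerX K := PowerSeries.C yVar
  let yL : LSerX K := (y : LSerX K)
  let wL : LSerX K := (w : LSerX K)
  (ρ : LSerX K) / (yL - wL) *
    (expX (cst (imag * u / (2 * s * t)) * (w ^ 2 - y ^ 2) + cst s⁻¹ * (y - w)) : LSerX K) *
    (yL / wL) ^ S.charge *
    normalExpCoeff (fun n => (wL ^ (-n) - yL ^ (-n)) / (n : LSerX K)) T S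

end Operators

end BosonFermion

end

/-!
The operator `s D` is of first order in `y = z⁻¹`: with `q = t/iu` and `a = s q y / (y - q)` it is
multiplication by `y` plus the Lie derivative of the vector field `a d/dy` on half-densities
(`smul_opD_apply`). Hence `e^{xsD}` is computed by the flow of `a d/dy`. Everything about it is read
off from linear equations for the derivation `d/dx - a d/dy`, each of which has exactly one solution
with given value at `x = 0` (`exists_transport`, `eq_of_transport`). The function `w` on the curve is
the image of `y` under the flow, that is the solution of `(d/dx - a d/dy) w = 0` with `w = y` at
`x = 0` (`OnCurve.transport_eq_zero`, `OnCurve.of_transport`); the root `ρ` of `dw/dy` is transported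
with half of the divergence of the field (`isSqrtDeriv_of_transport`); and the exponential factor `Φ`
of the integrand accounts for the multiplication by `y` (`transport_phase`). It follows that the
symbol of index `n` is `Φ ρ (y/w)^{n+1}` (`coe_symbol`), so the symbols form a geometric progression
with ratio `y/w`.

By this formula `e^{xsD}` is the contour integral of `Φ ρ ψ(y) ψ^*(w)`, where
`ψ(y) ψ^*(w) = ∑ y^i w^{-1-j} ψ_i ψ_j^*` has the vacuum expectation `1 / (y - w)`
(`expCoeff_eq_of_symbol`). What remains is the bosonization of `ψ(y) ψ^*(w)`
(`fermionForm_eq_bosonForm`), for two elements `y ≠ w` of a field. Both sides have the commutator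
`(y^n - w^n)` times themselves with `α_n`: for the fermionic side this follows from the commutators
of `α_n` with `ψ_i` and `ψ_j^*` (`fermionForm_alpha`), for the bosonic side from the Heisenberg
relations `alpha_alpha` (`bosonForm_alpha`). Both sides have the same expectation on the ground state
of each charge. These properties determine a form (`form_eq_zero`): the operator
`∑_{n > 0} α_{-n} α_n` acts on `v_S` by the energy of `S`, the size of the partition attached to `S`
(`sum_alpha_alpha_vec`), so that by the commutation relations a matrix coefficient of positive energy
is expressed by matrix coefficients of smaller energy.
-/

noncomputable section

namespace BosonFermion

/-! ### Derivations of formal series -/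

section Series

variable {K : Type*} [Field K]

/-- Leibniz rule for the derivative of Laurent series. -/
theorem laurentDerivative_mul (f g : Ser K) :
    LaurentSeries.derivative K (f * g) =
      f * LaurentSeries.derivative K g + g * LaurentSeries.derivative K f := by
  -- Multiplied by `z`, the derivative becomes the Euler operator `(θ f)_n = n f_n`, which does not
  -- enlarge the support.
  have key : ∀ (h : Ser K) (n : ℤ),
      (HahnSeries.single (1 : ℤ) (1 : K) * LaurentSeries.derivative K h).coeff n =
        (n : K) * h.coeff n := by
    intro h n
    have := HahnSeries.coeff_single_mul_add (r := (1 : K)) (x := LaurentSeries.derivative K h)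
      (a := n - 1) (b := (1 : ℤ))
    rw [sub_add_cancel] at this
    rw [this, LaurentSeries.derivative_apply, LaurentSeries.hasseDeriv_coeff]
    simp
  have hz : (HahnSeries.single (1 : ℤ) (1 : K)) ≠ 0 := by simp
  apply mul_left_cancel₀ hz
  have hs : ∀ h : Ser K, (HahnSeries.single (1 : ℤ) (1 : K) *
      LaurentSeries.derivative K h).support ⊆ h.support := by
    intro h n hn
    rw [HahnSeries.mem_support, key] at hn
    exact right_ne_zero_of_mul hn
  rw [show HahnSeries.single (1 : ℤ) (1 : K) * (f * LaurentSeries.derivative K g +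
      g * LaurentSeries.derivative K f) =
      f * (HahnSeries.single (1 : ℤ) (1 : K) * LaurentSeries.derivative K g) +
      (HahnSeries.single (1 : ℤ) (1 : K) * LaurentSeries.derivative K f) * g by ring]
  ext n
  rw [key, HahnSeries.coeff_add, HahnSeries.coeff_mul,
    HahnSeries.coeff_mul_right' g.isPWO_support (hs g),
    HahnSeries.coeff_mul_left' f.isPWO_support (hs f), Finset.mul_sum, ← Finset.sum_add_distrib]
  refine Finset.sum_congr rfl fun p hp => ?_
  rw [key, key, ← (Finset.mem_antidiagonal.1 hp).2.2]
  push_cast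
  ring

/-- `d/dy = -z² d/dz` on Laurent series in `z = y⁻¹`. -/
def dY : Ser K →+ Ser K where
  toFun f := -(HahnSeries.single 2 1 * LaurentSeries.derivative K f)
  map_zero' := by simp
  map_add' f g := by rw [map_add]; ring

theorem dY_apply (f : Ser K) :
    dY f = -(HahnSeries.single 2 1 * LaurentSeries.derivative K f) := rfl

theorem dY_mul (f g : Ser K) : dY (f * g) = f * dY g + dY f * g := by
  simp only [dY_apply, laurentDerivative_mul]
  ring

theorem dY_smul (c : K) (f : Ser K) : dY (c • f) = c • dY f := by
  rw [dY_apply, dY_apply, map_smul, ← HahnSeries.C_mul_eq_smul, ← HahnSeries.C_mul_eq_smul]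
  ring

theorem dY_C (c : K) : dY (HahnSeries.C c : Ser K) = 0 := by
  rw [dY_apply, HahnSeries.C_apply, LaurentSeries.derivative_apply,
    LaurentSeries.hasseDeriv_single]
  simp

theorem dY_yVar : dY (yVar : Ser K) = 1 := by
  rw [dY_apply, yVar, LaurentSeries.derivative_apply, LaurentSeries.hasseDeriv_single,
    HahnSeries.single_mul_single, Ring.choose_one_right]
  norm_num

theorem coeff_derivY (f : SerX K) (m : ℕ) :
    PowerSeries.coeff m (derivY f) = dY (PowerSeries.coeff m f) := by
  simp [derivY, dY_apply]

theorem derivY_add (f g : SerX K) : derivY (f + g) = derivY f + derivY g := by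
  ext1 m
  simp only [coeff_derivY, map_add]

theorem derivY_mul (f g : SerX K) : derivY (f * g) = f * derivY g + derivY f * g := by
  ext1 m
  simp only [coeff_derivY, map_add, PowerSeries.coeff_mul, map_sum, dY_mul,
    Finset.sum_add_distrib]

theorem derivY_C (f : Ser K) : derivY (PowerSeries.C f) = PowerSeries.C (dY f) := by
  ext1 m
  rw [coeff_derivY, PowerSeries.coeff_C, PowerSeries.coeff_C]
  split_ifs <;> simp

theorem derivY_X : derivY (PowerSeries.X : SerX K) = 0 := by
  ext1 m
  rw [coeff_derivY, PowerSeries.coeff_X]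
  have : dY (1 : Ser K) = 0 := dY_C 1
  split_ifs <;> simp [this]

/-- The derivation `d/dx - a d/dy`. Its kernel consists of the functions `e^{x a d/dy} f`, that is
of the functions of `y` pulled back along the flow of the vector field `a d/dy` for the time `x`. -/
def transport (a : Ser K) : SerX K →+ SerX K where
  toFun f := PowerSeries.derivative (Ser K) f - PowerSeries.C a * derivY f
  map_zero' := by
    have : derivY (0 : SerX K) = 0 := by simpa using derivY_C (0 : Ser K)
    simp [this]
  map_add' f g := by rw [map_add, derivY_add]; ring

theorem transport_apply (a : Ser K) (f : SerX K) :
    transport a f = PowerSeries.derivative (Ser K) f - PowerSeries.C a * derivY f := rfl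

theorem transport_mul (a : Ser K) (f g : SerX K) :
    transport a (f * g) = f * transport a g + transport a f * g := by
  simp only [transport_apply, derivY_mul, Derivation.leibniz, smul_eq_mul]
  ring

theorem transport_C (a f : Ser K) :
    transport a (PowerSeries.C f) = PowerSeries.C (-(a * dY f)) := by
  rw [transport_apply, PowerSeries.derivative_C, derivY_C]
  simp

theorem transport_X (a : Ser K) : transport a (PowerSeries.X : SerX K) = 1 := by
  rw [transport_apply, derivY_X, PowerSeries.derivative_X]
  simp

theorem transport_cst (a : Ser K) (c : K) : transport a (cst c) = 0 := by
  rw [cst, transport_C, dY_C]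
  simp

/-! ### The exponential of a power series and transport equations -/

/-- The partial sums of the exponential series converge `X`-adically to `expX f`. -/
theorem expX_sub_partial_dvd {f : SerX K} (hf : PowerSeries.constantCoeff f = 0) (N : ℕ) :
    PowerSeries.X ^ N ∣ expX f -
      ∑ n ∈ Finset.range N, PowerSeries.C ((n.factorial : Ser K)⁻¹) * f ^ n := by
  rcases N with _ | N
  · simp
  have hs : PowerSeries.HasSubst f := PowerSeries.HasSubst.of_constantCoeff_zero' hf
  set E : SerX K := PowerSeries.mk fun n => ((n.factorial : Ser K))⁻¹ with hE
  have h1 : E = (PowerSeries.X ^ (N + 1) *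
      PowerSeries.mk fun i => PowerSeries.coeff (i + (N + 1)) E) +
      (PowerSeries.trunc (N + 1) E : SerX K) := PowerSeries.eq_X_pow_mul_shift_add_trunc (N + 1) E
  have h2 : expX f = E.subst f := rfl
  rw [h2, h1, PowerSeries.subst_add hs, PowerSeries.subst_mul hs, PowerSeries.subst_pow hs,
    PowerSeries.subst_X hs, PowerSeries.subst_coe hs]
  have h3 : Polynomial.aeval f (PowerSeries.trunc (N + 1) E) =
      ∑ n ∈ Finset.range (N + 1), PowerSeries.C ((n.factorial : Ser K)⁻¹) * f ^ n := by
    rw [Polynomial.aeval_eq_sum_range' (PowerSeries.natDegree_trunc_lt E N)]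
    refine Finset.sum_congr rfl fun n hn => ?_
    rw [PowerSeries.coeff_trunc, if_pos (Finset.mem_range.1 hn), hE, PowerSeries.coeff_mk,
      PowerSeries.smul_eq_C_mul]
  rw [h3, add_sub_cancel_right]
  exact Dvd.dvd.mul_right (pow_dvd_pow_of_dvd (PowerSeries.X_dvd_iff.2 hf) (N + 1)) _

theorem constantCoeff_expX {f : SerX K} (hf : PowerSeries.constantCoeff f = 0) :
    PowerSeries.constantCoeff (expX f) = 1 := by
  obtain ⟨R, hR⟩ := expX_sub_partial_dvd hf 1
  have h := congrArg PowerSeries.constantCoeff hR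
  simp at h
  linear_combination h

variable [CharZero K]

instance charZero_ser : CharZero (Ser K) :=
  charZero_of_injective_ringHom (HahnSeries.C_injective : Function.Injective
    (HahnSeries.C : K →+* Ser K))

/-- The chain rule for the exponential. The derivation `D` is arbitrary: it need not be linear over
the coefficients, and its `X`-adic continuity is automatic. -/
theorem derivation_expX (D : SerX K →+ SerX K)
    (hD : ∀ f g, D (f * g) = f * D g + D f * g) {f : SerX K}
    (hf : PowerSeries.constantCoeff f = 0) : D (expX f) = D f * expX f := by
  set e : ℕ → SerX K := fun N =>
    ∑ n ∈ Finset.range N, PowerSeries.C ((n.factorial : Ser K)⁻¹) * f ^ n with he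
  have hone : D 1 = 0 := by
    have h := hD 1 1
    simpa using h
  have hnat : ∀ n : ℕ, D (n : SerX K) = 0 := by
    intro n
    rw [← nsmul_one, map_nsmul, hone, smul_zero]
  have hpow : ∀ (g : SerX K) (n : ℕ), D (g ^ (n + 1)) = ((n + 1 : ℕ) : SerX K) * g ^ n * D g := by
    intro g n
    induction n with
    | zero => simp
    | succ n ih =>
      rw [pow_succ, hD, ih]
      push_cast
      ring
  have hcst : ∀ n : ℕ, D (PowerSeries.C ((n.factorial : Ser K)⁻¹)) = 0 := by
    intro n
    have hn : (n.factorial : Ser K) ≠ 0 := by exact_mod_cast n.factorial_ne_zero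
    have h1 : ((n.factorial : ℕ) : SerX K) * PowerSeries.C ((n.factorial : Ser K)⁻¹) = 1 := by
      rw [← map_natCast (PowerSeries.C (R := Ser K)), ← map_mul, mul_inv_cancel₀ hn, map_one]
    have h2 := congrArg D h1
    rw [hD, hnat, hone, zero_mul, add_zero] at h2
    refine (mul_eq_zero.1 h2).resolve_left fun h => ?_
    rw [h, zero_mul] at h1
    exact zero_ne_one h1
  have hDe : ∀ N, D (e (N + 1)) = D f * e N := by
    intro N
    rw [he]
    simp only [map_sum, Finset.mul_sum]
    rw [Finset.sum_range_succ']
    have h0 : D (PowerSeries.C ((Nat.factorial 0 : Ser K)⁻¹) * f ^ 0) = 0 := by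
      rw [pow_zero, mul_one]; exact hcst 0
    rw [h0, add_zero]
    refine Finset.sum_congr rfl fun n _ => ?_
    rw [hD, hcst, zero_mul, add_zero, hpow, Nat.factorial_succ]
    have hn : ((n : Ser K) + 1) ≠ 0 := by exact_mod_cast n.succ_ne_zero
    have h3 : PowerSeries.C (((n + 1) * n.factorial : ℕ) : Ser K)⁻¹ * ((n + 1 : ℕ) : SerX K) =
        PowerSeries.C (n.factorial : Ser K)⁻¹ := by
      rw [← map_natCast (PowerSeries.C (R := Ser K)), ← map_mul]
      congr 1
      push_cast
      field_simp
    rw [← h3]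
    ring
  rw [← sub_eq_zero]
  have hdvd : ∀ N, PowerSeries.X ^ N ∣ D (expX f) - D f * expX f := by
    intro N
    obtain ⟨R, hR⟩ := expX_sub_partial_dvd hf (N + 1)
    obtain ⟨R', hR'⟩ := expX_sub_partial_dvd hf N
    have h4 : D (expX f) - D f * expX f = D (expX f - e (N + 1)) - D f * (expX f - e N) := by
      rw [map_sub, hDe]; ring
    rw [h4]
    change _ = PowerSeries.X ^ (N + 1) * R at hR
    change _ = PowerSeries.X ^ N * R' at hR'
    rw [show expX f - e (N + 1) = PowerSeries.X ^ (N + 1) * R from hR,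
      show expX f - e N = PowerSeries.X ^ N * R' from hR', hD, hpow]
    refine ⟨PowerSeries.X * D R + R * (((N + 1 : ℕ) : SerX K) * D PowerSeries.X) - D f * R', ?_⟩
    ring
  ext1 m
  obtain ⟨R, hR⟩ := hdvd (m + 1)
  rw [hR, PowerSeries.coeff_X_pow_mul', if_neg (by omega), map_zero]

/-- A linear transport equation is a recursion for the coefficients of `x^m`. -/
theorem coeff_succ_of_transport {a b : Ser K} {F : SerX K}
    (h : transport a F = PowerSeries.C b * F) (m : ℕ) :
    PowerSeries.coeff (m + 1) F = ((m + 1 : ℕ) : Ser K)⁻¹ *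
      (a * dY (PowerSeries.coeff m F) + b * PowerSeries.coeff m F) := by
  have h1 := congrArg (PowerSeries.coeff m) h
  rw [transport_apply, map_sub, PowerSeries.coeff_derivative, PowerSeries.coeff_C_mul,
    PowerSeries.coeff_C_mul, coeff_derivY] at h1
  have h2 : ((m + 1 : ℕ) : Ser K) ≠ 0 := by exact_mod_cast m.succ_ne_zero
  rw [eq_inv_mul_iff_mul_eq₀ h2]
  push_cast
  linear_combination h1

/-- A linear transport equation has at most one solution with given initial value. -/
theorem eq_of_transport {a b : Ser K} {F G : SerX K}
    (hF : transport a F = PowerSeries.C b * F) (hG : transport a G = PowerSeries.C b * G)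
    (h0 : PowerSeries.constantCoeff F = PowerSeries.constantCoeff G) : F = G := by
  ext1 m
  induction m with
  | zero => simpa using h0
  | succ m ih => rw [coeff_succ_of_transport hF, coeff_succ_of_transport hG, ih]

/-- The exponential of `x L` solves the transport equation of a first order operator `L`. -/
theorem transport_exp_mk {a b : Ser K} (L : Module.End K (Ser K))
    (hL : ∀ f, L f = a * dY f + b * f) (f₀ : Ser K) :
    transport a (PowerSeries.mk fun m => (m.factorial : K)⁻¹ • (L ^ m) f₀) =
      PowerSeries.C b * PowerSeries.mk fun m => (m.factorial : K)⁻¹ • (L ^ m) f₀ := by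
  ext1 m
  rw [transport_apply, map_sub, PowerSeries.coeff_derivative, PowerSeries.coeff_C_mul,
    PowerSeries.coeff_C_mul, coeff_derivY, PowerSeries.coeff_mk, PowerSeries.coeff_mk, pow_succ',
    Module.End.mul_apply, hL, dY_smul, Nat.factorial_succ]
  have h2 : ((m : K) + 1) ≠ 0 := by exact_mod_cast m.succ_ne_zero
  have h3 : (((m + 1) * m.factorial : ℕ) : K)⁻¹ * ((m : K) + 1) = (m.factorial : K)⁻¹ := by
    push_cast
    field_simp
  have h4 : ((m : Ser K) + 1) = HahnSeries.C ((m : K) + 1) := by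
    rw [map_add, map_natCast, map_one]
  simp only [← HahnSeries.C_mul_eq_smul]
  rw [← h3, h4, map_mul]
  ring

/-- A linear transport equation is solvable for every initial value. -/
theorem exists_transport (a b f₀ : Ser K) :
    ∃ F : SerX K, PowerSeries.constantCoeff F = f₀ ∧
      transport a F = PowerSeries.C b * F := by
  let L : Module.End K (Ser K) :=
    { toFun := fun f => a * dY f + b * f
      map_add' := fun f g => by rw [map_add]; ring
      map_smul' := fun c f => by
        rw [dY_smul, RingHom.id_apply]
        simp only [← HahnSeries.C_mul_eq_smul]
        ring }
  refine ⟨_, ?_, transport_exp_mk L (fun f => rfl) f₀⟩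
  simp

end Series

/-! ### The dressed operator, the curve and the symbols -/

section Curve

variable {K : Type*} [Field K]

theorem yVar_ne_zero : (yVar : Ser K) ≠ 0 := by simp [yVar]

theorem single_eq_yVar_zpow (n : ℤ) : (HahnSeries.single n 1 : Ser K) = yVar ^ (-n) := by
  rw [RatFunc.single_zpow, yVar, RatFunc.single_zpow (-1), ← zpow_mul, neg_mul_neg, one_mul]

theorem derivY_derivative_comm (f : SerX K) :
    derivY (PowerSeries.derivative (Ser K) f) = PowerSeries.derivative (Ser K) (derivY f) := by
  ext1 m
  rw [coeff_derivY, PowerSeries.coeff_derivative, PowerSeries.coeff_derivative, coeff_derivY,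
    dY_mul]
  have h : ((m : Ser K) + 1) = HahnSeries.C ((m : K) + 1) := by
    rw [map_add, map_natCast, map_one]
  rw [h, dY_C]
  ring

theorem HahnC_mul_inv {c : K} (hc : c ≠ 0) :
    (HahnSeries.C c : Ser K) * HahnSeries.C c⁻¹ = 1 := by
  rw [← map_mul, mul_inv_cancel₀ hc, map_one]

theorem yVar_sub_C_ne_zero (q : K) : (yVar - HahnSeries.C q : Ser K) ≠ 0 := by
  intro h
  have := congrArg (fun f : Ser K => f.coeff (-1)) h
  simp [yVar, HahnSeries.C_apply, HahnSeries.coeff_single_of_ne] at this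

theorem C_two_inv : (HahnSeries.C (2 : K)⁻¹ : Ser K) = 2⁻¹ := by
  rw [map_inv₀, map_ofNat]

/-- `e^{xB} z^n`, as a power series in `x`. -/
theorem mul_symbol_eq (B : Module.End K (Ser K)) (n : ℤ) :
    PowerSeries.C (HahnSeries.single n 1) * symbol B n =
      PowerSeries.mk fun m => (m.factorial : K)⁻¹ • (B ^ m) (HahnSeries.single n 1) := by
  ext1 m
  rw [PowerSeries.coeff_C_mul, symbol, PowerSeries.coeff_mk, PowerSeries.coeff_mk]
  simp only [← HahnSeries.C_mul_eq_smul]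
  have h : (HahnSeries.single n 1 : Ser K) * HahnSeries.single (-n) 1 = 1 := by
    rw [HahnSeries.single_mul_single]
    simp
  linear_combination (HahnSeries.C (m.factorial : K)⁻¹ * (B ^ m) (HahnSeries.single n 1)) * h

/-- Half-densities are transported with half of the divergence of the vector field: `ρ²` and `dw/dy`
solve the same linear transport equation. -/
theorem isSqrtDeriv_of_transport [CharZero K] {a : Ser K} {w ρ : SerX K}
    (hw0 : PowerSeries.constantCoeff w = yVar) (hw : transport a w = 0)
    (h0 : PowerSeries.constantCoeff ρ = 1)
    (hρ : transport a ρ = PowerSeries.C (2⁻¹ * dY a) * ρ) : IsSqrtDeriv w ρ := by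
  refine ⟨h0, eq_of_transport (a := a) (b := dY a) ?_ ?_ ?_⟩
  · rw [sq, transport_mul, hρ]
    have h2 : (2⁻¹ * dY a : Ser K) + 2⁻¹ * dY a = dY a := by
      rw [← add_mul, ← two_mul, mul_inv_cancel₀ two_ne_zero, one_mul]
    rw [← h2, map_add, h2]
    ring
  · have h1 : PowerSeries.derivative (Ser K) w = PowerSeries.C a * derivY w :=
      sub_eq_zero.1 hw
    rw [transport_apply, ← derivY_derivative_comm, h1, derivY_mul, derivY_C]
    ring
  · rw [map_pow, h0, ← PowerSeries.coeff_zero_eq_constantCoeff_apply, coeff_derivY,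
      PowerSeries.coeff_zero_eq_constantCoeff_apply, hw0, dY_yVar, one_pow]

theorem IsSqrtDeriv.unique [CharZero K] {w ρ ρ' : SerX K} (h : IsSqrtDeriv w ρ)
    (h' : IsSqrtDeriv w ρ') :
    ρ' = ρ := by
  rcases sq_eq_sq_iff_eq_or_eq_neg.1 (h'.2.trans h.2.symm) with h1 | h1
  · exact h1
  · have h2 := congrArg PowerSeries.constantCoeff h1
    rw [map_neg, h.1, h'.1] at h2
    have h3 : (2 : Ser K) = 0 := by linear_combination h2
    exact absurd h3 two_ne_zero

variable [Algebra ℂ K]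

theorem imag_ne_zero : (imag : K) ≠ 0 := by
  rw [imag, Ne, map_eq_zero]
  exact Complex.I_ne_zero

/-- The function `∑_{n > 0} (t/iu)^n z^n = q/(y - q)`, `q = t/iu`. -/
def geomA (u t : K) : Ser K :=
  ((PowerSeries.mk fun n => if n = 0 then 0 else (t / (imag * u)) ^ n : PowerSeries K) : Ser K)

theorem geomA_mul (u t : K) :
    (yVar - HahnSeries.C (t / (imag * u))) * geomA u t = HahnSeries.C (t / (imag * u)) := by
  set q := t / (imag * u)
  have h1 : (1 - PowerSeries.C q * PowerSeries.X) *
      (PowerSeries.mk fun n => if n = 0 then 0 else q ^ n : PowerSeries K) =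
      PowerSeries.C q * PowerSeries.X := by
    ext n
    rw [sub_mul, one_mul, mul_assoc, map_sub, PowerSeries.coeff_C_mul, PowerSeries.coeff_C_mul]
    rcases n with _ | n
    · simp
    · rw [PowerSeries.coeff_succ_X_mul, PowerSeries.coeff_mk, PowerSeries.coeff_mk,
        PowerSeries.coeff_X]
      rcases n with _ | n
      · simp
      · simp [pow_succ']
  have h2 := congrArg (HahnSeries.ofPowerSeries ℤ K) h1
  rw [map_mul, map_sub, map_mul, map_one, HahnSeries.ofPowerSeries_C,
    HahnSeries.ofPowerSeries_X] at h2
  have h3 : (yVar : Ser K) * HahnSeries.single 1 1 = 1 := by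
    rw [yVar, HahnSeries.single_mul_single]
    simp
  change _ * geomA u t = _ at h2
  linear_combination yVar * h2 + (HahnSeries.C q) * (1 + geomA u t) * h3

/-- The coefficient `a = s q y / (y - q)` of the vector field `a d/dy`, the first order part of
`s D`. -/
def fieldA (u t s : K) : Ser K := HahnSeries.C s * (yVar * geomA u t)

theorem geomA_ne_zero {u t : K} (hu : u ≠ 0) (ht : t ≠ 0) : geomA u t ≠ 0 := by
  intro h
  have h1 := geomA_mul u t
  rw [h, mul_zero] at h1
  exact div_ne_zero ht (mul_ne_zero imag_ne_zero hu) (HahnSeries.C_injective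
    (h1.symm.trans (map_zero _).symm))

/-- The exponential factor of the integrand. -/
def phase (u t s : K) (w : SerX K) : SerX K :=
  expX (cst (imag * u / (2 * s * t)) * (w ^ 2 - PowerSeries.C yVar ^ 2) +
    cst s⁻¹ * (PowerSeries.C yVar - w))

theorem phase_exponent_constantCoeff (u t s : K) {w : SerX K}
    (h0 : PowerSeries.constantCoeff w = yVar) :
    PowerSeries.constantCoeff (cst (imag * u / (2 * s * t)) * (w ^ 2 - PowerSeries.C yVar ^ 2) +
      cst s⁻¹ * (PowerSeries.C yVar - w)) = 0 := by
  simp [h0]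

variable [CharZero K]

/-- The operator `s D` in the coordinate `y`: it is multiplication by `y` plus the Lie derivative
along `a d/dy`, where `f` stands for the half-density `(f / y) √dy`. Indeed
`y (a (f / y)' + a' f / (2 y)) = a f' + (a' / 2 - a / y) f`, and `a / y` is `s` times `geomA`. -/
theorem smul_opD_apply {u t s : K} (hs : s ≠ 0) (f : Ser K) :
    (s • opD u t s) f = fieldA u t s * dY f +
      (yVar + 2⁻¹ * dY (fieldA u t s) - HahnSeries.C s * geomA u t) * f := by
  have hH : ∀ g : Ser K, opH g = -(yVar * dY g) + HahnSeries.C (2 : K)⁻¹ * g := by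
    intro g
    have h3 : (yVar : Ser K) * HahnSeries.single 2 1 = HahnSeries.single 1 1 := by
      rw [yVar, HahnSeries.single_mul_single]
      norm_num
    have h4 : opH g = HahnSeries.single 1 1 * LaurentSeries.derivative K g + (2 : K)⁻¹ • g := rfl
    rw [h4, dY_apply, ← h3, HahnSeries.C_mul_eq_smul]
    ring
  have hA : ∀ g : Ser K, alphaSum u t g = geomA u t * g := fun g => rfl
  have hα : alphaV 1 f = yVar * f := rfl
  have hD : (s • opD u t s) f = s • (s⁻¹ • alphaV 1 f -
      (2 : K)⁻¹ • (opH (alphaSum u t f) + alphaSum u t (opH f))) := rfl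
  rw [hD, hα, hA, hA, hH, hH, fieldA]
  simp only [← HahnSeries.C_mul_eq_smul, dY_mul, dY_C, dY_yVar, C_two_inv]
  linear_combination (yVar * f) * HahnC_mul_inv hs

/-- Differentiating the equation of the curve along `d/dx - a d/dy` gives `(y - (iu/t) y w) w' = 0`
for the image `w'` of `w`, and the first factor is not zero. -/
theorem OnCurve.transport_eq_zero {u t s : K} (hu : u ≠ 0) (ht : t ≠ 0) {w : SerX K}
    (hw : OnCurve u t s w) : transport (fieldA u t s) w = 0 := by
  obtain ⟨h0, h1⟩ := hw
  set p := imag * u / t with hp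
  set a := fieldA u t s with ha
  have hpq : (HahnSeries.C p : Ser K) * HahnSeries.C (t / (imag * u)) = 1 := by
    rw [← map_mul, hp, div_mul_div_cancel₀ ht, div_self (mul_ne_zero imag_ne_zero hu), map_one]
  set f := cst p * (PowerSeries.C yVar - w) + cst s * PowerSeries.X with hf
  have hf0 : PowerSeries.constantCoeff f = 0 := by simp [hf, h0]
  have hδf : transport a f = cst p * (PowerSeries.C (-a) - transport a w) + cst s := by
    rw [hf, map_add, transport_mul, transport_mul, transport_cst, transport_cst, transport_X,
      map_sub, transport_C, dY_yVar]
    simp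
  have h2 := congrArg (transport a) h1
  rw [transport_mul, derivation_expX _ (transport_mul a) hf0, hδf, transport_C, dY_yVar] at h2
  have h3 : yVar * (HahnSeries.C s - HahnSeries.C p * a) = -a := by
    have := geomA_mul u t
    rw [ha, fieldA]
    linear_combination (-yVar * HahnSeries.C s * HahnSeries.C p) * this
      - (yVar * HahnSeries.C s * (1 + geomA u t)) * hpq
  have h4 := congrArg (PowerSeries.C (R := Ser K)) h3
  simp only [map_mul, map_sub, map_neg, map_one] at h4 h2
  have h5 : transport a w * ((1 - cst p * w) * PowerSeries.C yVar) = 0 := by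
    simp only [cst] at h2 h4 h1 ⊢
    linear_combination (-w) * h2 - w * h4 + (transport a w * (1 -
      PowerSeries.C (HahnSeries.C p) * w) + w * (PowerSeries.C (HahnSeries.C s) -
      PowerSeries.C (HahnSeries.C p) * PowerSeries.C a)) * h1
  refine (mul_eq_zero.1 h5).resolve_right (mul_ne_zero (fun h => ?_) fun h => ?_)
  · have h6 := congrArg PowerSeries.constantCoeff h
    simp only [cst, map_sub, map_one, map_mul, PowerSeries.constantCoeff_C, h0, map_zero] at h6
    refine yVar_sub_C_ne_zero (t / (imag * u)) ?_
    linear_combination (-HahnSeries.C (t / (imag * u))) * h6 - yVar * hpq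
  · exact yVar_ne_zero (by simpa using congrArg PowerSeries.constantCoeff h)

/-- If `w` is constant along `d/dx - a d/dy`, then both sides of the equation of the curve solve the
same linear transport equation, with the same initial value. -/
theorem OnCurve.of_transport {u t s : K} (hu : u ≠ 0) (ht : t ≠ 0) {w : SerX K}
    (h0 : PowerSeries.constantCoeff w = yVar) (hw : transport (fieldA u t s) w = 0) :
    OnCurve u t s w := by
  refine ⟨h0, ?_⟩
  set p := imag * u / t with hp
  set a := fieldA u t s with ha
  have hpq : (HahnSeries.C p : Ser K) * HahnSeries.C (t / (imag * u)) = 1 := by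
    rw [← map_mul, hp, div_mul_div_cancel₀ ht, div_self (mul_ne_zero imag_ne_zero hu), map_one]
  set f := cst p * (PowerSeries.C yVar - w) + cst s * PowerSeries.X with hf
  have hf0 : PowerSeries.constantCoeff f = 0 := by simp [hf, h0]
  have hδf : transport a f = PowerSeries.C (HahnSeries.C s - HahnSeries.C p * a) := by
    rw [hf, map_add, transport_mul, transport_mul, transport_cst, transport_cst, transport_X,
      map_sub, transport_C, dY_yVar, hw]
    simp only [cst, map_sub, map_mul, map_neg, mul_one]
    ring
  refine eq_of_transport (a := a) (b := HahnSeries.C s - HahnSeries.C p * a) ?_ ?_ ?_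
  · rw [transport_C, dY_yVar, ← map_mul]
    congr 1
    have := geomA_mul u t
    rw [ha, fieldA]
    linear_combination (yVar * HahnSeries.C s * HahnSeries.C p) * this
      + (yVar * HahnSeries.C s * (1 + geomA u t)) * hpq
  · rw [transport_mul, hw, derivation_expX _ (transport_mul a) hf0, hδf]
    ring
  · rw [map_mul, constantCoeff_expX hf0, h0]
    simp

theorem OnCurve.unique {u t s : K} (hu : u ≠ 0) (ht : t ≠ 0) {w w' : SerX K}
    (hw : OnCurve u t s w) (hw' : OnCurve u t s w') : w' = w := by
  refine eq_of_transport (a := fieldA u t s) (b := 0) ?_ ?_ (hw'.1.trans hw.1.symm)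
  · simpa using hw'.transport_eq_zero hu ht
  · simpa using hw.transport_eq_zero hu ht

/-- The exponent of `phase` is the integral of `y` along the flow for the time `x`. -/
theorem transport_phase {u t s : K} (hu : u ≠ 0) (ht : t ≠ 0) (hs : s ≠ 0) {w : SerX K}
    (h0 : PowerSeries.constantCoeff w = yVar) (hw : transport (fieldA u t s) w = 0) :
    transport (fieldA u t s) (phase u t s w) = PowerSeries.C yVar * phase u t s w := by
  rw [phase, derivation_expX _ (transport_mul _) (phase_exponent_constantCoeff u t s h0)]
  congr 1
  rw [map_add, transport_mul, transport_mul, map_sub, map_sub, sq, sq, transport_mul,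
    transport_mul, transport_cst, transport_cst, transport_C, dY_yVar, hw]
  set c := imag * u / (2 * s * t) with hc
  set a := fieldA u t s with ha
  have h1 : a * (HahnSeries.C c * (2 * yVar) - HahnSeries.C s⁻¹) = yVar := by
    have hcs : (HahnSeries.C c : Ser K) * (2 * HahnSeries.C s * HahnSeries.C (t / (imag * u)))
        = 1 := by
      have := imag_ne_zero (K := K)
      rw [show (2 : Ser K) = HahnSeries.C (2 : K) by rw [map_ofNat], ← map_mul, ← map_mul,
        ← map_mul, hc, ← map_one (HahnSeries.C : K →+* Ser K)]
      congr 1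
      have h2 : (2 : K) ≠ 0 := two_ne_zero
      field_simp
    have h3 := HahnC_mul_inv hs
    have h4 := geomA_mul u t
    rw [ha, fieldA]
    linear_combination (2 * HahnSeries.C c * HahnSeries.C s * yVar) * h4 +
      yVar * (1 + geomA u t) * hcs - yVar * geomA u t * h3
  have h2 := congrArg (PowerSeries.C (R := Ser K)) h1
  simp only [map_mul, map_sub, map_ofNat] at h2
  simp only [cst, map_neg, mul_one, zero_mul, mul_zero, sub_zero, add_zero]
  linear_combination h2

/-- Multiplication by `w`, a constant of `d/dx - a d/dy`, sends `e^{xsD} z^n` to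
`e^{xsD} z^{n-1}`. -/
theorem symbol_pred {u t s : K} (hs : s ≠ 0) {w : SerX K}
    (h0 : PowerSeries.constantCoeff w = yVar) (hw : transport (fieldA u t s) w = 0) (n : ℤ) :
    PowerSeries.C yVar * symbol (s • opD u t s) (n - 1) = w * symbol (s • opD u t s) n := by
  have h1 : ∀ m, _ := fun m => transport_exp_mk _ (smul_opD_apply (u := u) (t := t) hs)
    (HahnSeries.single m 1)
  simp only [← mul_symbol_eq] at h1
  have h2 : PowerSeries.C (HahnSeries.single (n - 1) 1) * symbol (s • opD u t s) (n - 1) =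
      w * (PowerSeries.C (HahnSeries.single n 1) * symbol (s • opD u t s) n) := by
    refine eq_of_transport (h1 (n - 1)) ?_ ?_
    · rw [transport_mul, h1, hw]
      ring
    · rw [mul_symbol_eq, mul_symbol_eq, map_mul, h0]
      simp [yVar, HahnSeries.single_mul_single, sub_eq_neg_add]
  have h3 : (HahnSeries.single n 1 : Ser K) * yVar = HahnSeries.single (n - 1) 1 := by
    rw [yVar, HahnSeries.single_mul_single, mul_one, sub_eq_add_neg]
  rw [← h3, map_mul] at h2
  have h4 : PowerSeries.C (HahnSeries.single n (1 : K)) ≠ 0 := fun h => by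
    simpa using congrArg PowerSeries.constantCoeff h
  apply mul_left_cancel₀ h4
  linear_combination h2

/-- For the half-density `√dy`, that is for `z^{-1}`, only the half-density factor `ρ` and the
multiplication by `y` contribute to the symbol. -/
theorem symbol_neg_one {u t s : K} (hu : u ≠ 0) (ht : t ≠ 0) (hs : s ≠ 0) {w ρ : SerX K}
    (h0 : PowerSeries.constantCoeff w = yVar) (hw : transport (fieldA u t s) w = 0)
    (hρ0 : PowerSeries.constantCoeff ρ = 1)
    (hρ : transport (fieldA u t s) ρ = PowerSeries.C (2⁻¹ * dY (fieldA u t s)) * ρ) :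
    symbol (s • opD u t s) (-1) = phase u t s w * ρ := by
  have h1 := transport_exp_mk _ (smul_opD_apply (u := u) (t := t) hs)
    (HahnSeries.single (-1) 1)
  rw [← mul_symbol_eq] at h1
  have h4 : PowerSeries.C (HahnSeries.single (-1) (1 : K)) ≠ 0 := fun h => by
    simpa using congrArg PowerSeries.constantCoeff h
  apply mul_left_cancel₀ h4
  refine eq_of_transport h1 ?_ ?_
  · change transport _ (PowerSeries.C yVar * _) = _ * (PowerSeries.C yVar * _)
    rw [transport_mul, transport_mul, transport_phase hu ht hs h0 hw, hρ, transport_C, dY_yVar]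
    have h5 : fieldA u t s = HahnSeries.C s * geomA u t * yVar := by
      rw [fieldA]
      ring
    have h6 := congrArg (PowerSeries.C (R := Ser K)) h5
    simp only [map_mul, map_sub, map_add, map_neg, mul_one] at h6 ⊢
    linear_combination (-phase u t s w * ρ) * h6
  · rw [mul_symbol_eq, map_mul, map_mul, hρ0, phase,
      constantCoeff_expX (phase_exponent_constantCoeff u t s h0)]
    simp

end Curve

/-! ### Fermions -/

section Fermions

open Filter

namespace Maya

theorem ext {S T : Maya} (h : ∀ k, k ∈ S.1 ↔ k ∈ T.1) : S = T :=
  Subtype.ext (Set.ext h)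

theorem mem_insert {S : Maya} {k l : ℤ} : l ∈ (S.insert k).1 ↔ l = k ∨ l ∈ S.1 := Iff.rfl

theorem mem_erase {S : Maya} {k l : ℤ} : l ∈ (S.erase k).1 ↔ l ∈ S.1 ∧ l ≠ k := Iff.rfl

theorem finite_inter_Ici (S : Maya) (a : ℤ) : (S.1 ∩ Set.Ici a).Finite :=
  (S.2.1.union (Set.finite_Ico a 0)).subset fun x hx => by
    by_cases h : 0 ≤ x
    · exact Or.inl ⟨hx.1, h⟩
    · exact Or.inr ⟨hx.2, not_le.1 h⟩

theorem finite_Iio_diff (S : Maya) (a : ℤ) : (Set.Iio a \ S.1).Finite :=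
  (S.2.2.union (Set.finite_Ico 0 a)).subset fun x hx => by
    by_cases h : x < 0
    · exact Or.inl ⟨h, hx.2⟩
    · exact Or.inr ⟨not_lt.1 h, hx.1⟩

theorem finite_diff (S T : Maya) : (S.1 \ T.1).Finite :=
  (S.2.1.union T.2.2).subset fun x hx => by
    by_cases h : 0 ≤ x
    · exact Or.inl ⟨hx.1, h⟩
    · exact Or.inr ⟨not_le.1 h, hx.2⟩

theorem exists_upper (S : Maya) : ∃ b : ℤ, ∀ k ∈ S.1, k < b := by
  obtain ⟨b, hb⟩ := (S.finite_inter_Ici 0).bddAbove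
  refine ⟨max (b + 1) 0, fun k hk => ?_⟩
  by_cases h : 0 ≤ k
  · exact lt_max_of_lt_left (Int.lt_add_one_iff.2 (hb ⟨hk, h⟩))
  · exact lt_max_of_lt_right (not_le.1 h)

theorem exists_lower (S : Maya) : ∃ a : ℤ, ∀ k, k < a → k ∈ S.1 := by
  obtain ⟨a, ha⟩ := (S.finite_Iio_diff 0).bddBelow
  refine ⟨min a 0, fun k hk => ?_⟩
  by_contra h
  exact absurd (ha ⟨hk.trans_le (min_le_right _ _), h⟩) (not_le.2 (hk.trans_le (min_le_left _ _)))

theorem sign_mul_self (S : Maya) (k : ℤ) : S.sign k * S.sign k = 1 := by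
  rw [sign, ← mul_pow]
  simp

theorem sign_insert {S : Maya} {k : ℤ} (hk : k ∉ S.1) (l : ℤ) :
    (S.insert k).sign l = S.sign l * if l < k then -1 else 1 := by
  have hfin : (S.1 ∩ Set.Ioi l).Finite :=
    (S.finite_inter_Ici l).subset fun x hx => ⟨hx.1, (Set.mem_Ioi.1 hx.2).le⟩
  split_ifs with h
  · have : (S.insert k).1 ∩ Set.Ioi l = Insert.insert k (S.1 ∩ Set.Ioi l) :=
      Set.insert_inter_of_mem h
    rw [sign, this, Set.ncard_insert_of_notMem (fun hx => hk hx.1) hfin, pow_succ, sign]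
  · have : (S.insert k).1 ∩ Set.Ioi l = S.1 ∩ Set.Ioi l := Set.insert_inter_of_notMem h
    rw [sign, this, mul_one, sign]

theorem insert_erase {S : Maya} {k : ℤ} (hk : k ∈ S.1) : (S.erase k).insert k = S := by
  apply ext
  intro l
  rw [mem_insert, mem_erase]
  by_cases h : l = k <;> simp [h, hk]

theorem sign_erase {S : Maya} {k : ℤ} (hk : k ∈ S.1) (l : ℤ) :
    S.sign l = (S.erase k).sign l * if l < k then -1 else 1 := by
  conv_lhs => rw [← insert_erase hk]
  exact sign_insert (fun h => (mem_erase.1 h).2 rfl) l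

end Maya

variable {K : Type*} [Field K]

theorem psi_vec_of_mem {S : Maya} {k : ℤ} (h : k ∈ S.1) : psi K k (vec K S) = 0 := by
  simp [psi, vec, h]

theorem psi_vec_of_notMem {S : Maya} {k : ℤ} (h : k ∉ S.1) :
    psi K k (vec K S) = (S.sign k : K) • vec K (S.insert k) := by
  simp [psi, vec, h]

theorem psiStar_vec_of_mem {S : Maya} {k : ℤ} (h : k ∈ S.1) :
    psiStar K k (vec K S) = (S.sign k : K) • vec K (S.erase k) := by
  simp [psiStar, vec, h]

theorem psiStar_vec_of_notMem {S : Maya} {k : ℤ} (h : k ∉ S.1) : psiStar K k (vec K S) = 0 := by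
  simp [psiStar, vec, h]

theorem vec_induction {p : Fock K → Prop} (h0 : p 0) (hadd : ∀ u v, p u → p v → p (u + v))
    (hsmul : ∀ (c : K) S, p (vec K S) → p (c • vec K S)) (hvec : ∀ S, p (vec K S))
    (v : Fock K) : p v := by
  induction v using Finsupp.induction_linear with
  | zero => exact h0
  | add u v hu hv => exact hadd u v hu hv
  | single S c => simpa [vec] using hsmul c S (hvec S)

theorem end_ext_vec {A B : Module.End K (Fock K)} (h : ∀ S, A (vec K S) = B (vec K S)) :
    A = B := Finsupp.lhom_ext' fun S => LinearMap.ext_ring (h S)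

/-- The bilinear form in which the `v_S` are orthonormal. -/
def pairing : Fock K →ₗ[K] Fock K →ₗ[K] K := Finsupp.linearCombination K Finsupp.lapply

theorem pairing_vec (T : Maya) (v : Fock K) : pairing (vec K T) v = v T := by
  simp [pairing, vec]

theorem pairing_comm (u v : Fock K) : pairing u v = pairing v u := by
  induction u using vec_induction with
  | h0 => simp
  | hadd u₁ u₂ h₁ h₂ => simp only [map_add, LinearMap.add_apply, h₁, h₂]
  | hsmul c S h => simp only [map_smul, LinearMap.smul_apply, h]
  | hvec S =>
    induction v using vec_induction with
    | h0 => simp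
    | hadd u₁ u₂ h₁ h₂ => simp only [map_add, LinearMap.add_apply, h₁, h₂]
    | hsmul c S h => simp only [map_smul, LinearMap.smul_apply, h]
    | hvec T =>
      classical
      rw [pairing_vec, pairing_vec, vec, vec, Finsupp.single_apply, Finsupp.single_apply]
      simp only [eq_comm]

theorem ext_pairing {v w : Fock K} (h : ∀ u, pairing u v = pairing u w) : v = w := by
  ext T
  simpa only [pairing_vec] using h (vec K T)

/-- Two operators are adjoint as soon as they are so on basis vectors. -/
theorem adjoint_of_vec {A B : Module.End K (Fock K)}
    (h : ∀ S T, pairing (A (vec K S)) (vec K T) = pairing (vec K S) (B (vec K T)))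
    (u v : Fock K) : pairing (A u) v = pairing u (B v) := by
  induction u using vec_induction with
  | h0 => simp
  | hadd u₁ u₂ h₁ h₂ => simp only [map_add, LinearMap.add_apply, h₁, h₂]
  | hsmul c S h => simp only [map_smul, LinearMap.smul_apply, h]
  | hvec S =>
    induction v using vec_induction with
    | h0 => simp
    | hadd u₁ u₂ h₁ h₂ => simp only [map_add, h₁, h₂]
    | hsmul c S h => simp only [map_smul, h]
    | hvec T => exact h S T

theorem pairing_psi (k : ℤ) (u v : Fock K) :
    pairing (psi K k u) v = pairing u (psiStar K k v) := by
  classical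
  refine adjoint_of_vec (fun S T => ?_) u v
  rw [pairing_vec, pairing_comm, pairing_vec]
  by_cases hS : k ∈ S.1
  · rw [psi_vec_of_mem hS]
    by_cases hT : k ∈ T.1
    · rw [psiStar_vec_of_mem hT, Finsupp.smul_apply, vec, Finsupp.single_apply, if_neg]
      · simp
      · rintro rfl
        exact hS.2 rfl
    · rw [psiStar_vec_of_notMem hT]
      rfl
  · rw [psi_vec_of_notMem hS]
    by_cases hT : k ∈ T.1
    · rw [psiStar_vec_of_mem hT, Finsupp.smul_apply, Finsupp.smul_apply, vec, vec,
        Finsupp.single_apply, Finsupp.single_apply]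
      by_cases h : S.insert k = T
      · have h' : T.erase k = S := by
          subst h
          apply Maya.ext
          intro l
          rw [Maya.mem_erase, Maya.mem_insert]
          refine ⟨fun hl => hl.1.resolve_left hl.2, fun hl => ⟨Or.inr hl, ?_⟩⟩
          rintro rfl
          exact hS hl
        rw [if_pos h, if_pos h', ← h, Maya.sign_insert hS]
        simp
      · rw [if_neg h, if_neg]
        · simp
        · intro h'
          apply h
          rw [← h', Maya.insert_erase hT]
    · rw [psiStar_vec_of_notMem hT, Finsupp.smul_apply, vec, Finsupp.single_apply, if_neg]
      · simp
      · rintro rfl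
        exact hT (Or.inl rfl)

theorem pairing_psiStar (k : ℤ) (u v : Fock K) :
    pairing (psiStar K k u) v = pairing u (psi K k v) := by
  rw [pairing_comm, ← pairing_psi, pairing_comm]

theorem psi_mul_psi (i j : ℤ) : psi K i * psi K j = -(psi K j * psi K i) := by
  -- the case of two different empty sites, in the order `i < j`
  have key : ∀ {S : Maya} {i j : ℤ}, i < j → i ∉ S.1 → j ∉ S.1 →
      psi K i (psi K j (vec K S)) = -psi K j (psi K i (vec K S)) := by
    intro S i j hij hi hj
    have hi' : i ∉ (S.insert j).1 := fun h => h.elim (fun h => hij.ne h) hi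
    have hj' : j ∉ (S.insert i).1 := fun h => h.elim (fun h => hij.ne' h) hj
    have hins : (S.insert j).insert i = (S.insert i).insert j := by
      apply Maya.ext
      intro l
      simp only [Maya.mem_insert]
      tauto
    rw [psi_vec_of_notMem hi, psi_vec_of_notMem hj, map_smul, map_smul, psi_vec_of_notMem hi',
      psi_vec_of_notMem hj', hins, Maya.sign_insert hi, Maya.sign_insert hj, if_pos hij,
      if_neg hij.not_gt, smul_smul, smul_smul, ← neg_smul]
    push_cast
    congr 1
    ring
  have zero : ∀ {S : Maya} {i j : ℤ}, i ∈ S.1 → psi K i (psi K j (vec K S)) = 0 := by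
    intro S i j hi
    by_cases hj : j ∈ S.1
    · rw [psi_vec_of_mem hj, map_zero]
    · rw [psi_vec_of_notMem hj, map_smul, psi_vec_of_mem (Or.inr hi), smul_zero]
  refine end_ext_vec fun S => ?_
  rw [LinearMap.neg_apply, Module.End.mul_apply, Module.End.mul_apply]
  by_cases hi : i ∈ S.1
  · rw [zero hi, psi_vec_of_mem hi, map_zero, neg_zero]
  by_cases hj : j ∈ S.1
  · rw [zero hj, psi_vec_of_mem hj, map_zero, neg_zero]
  rcases lt_trichotomy i j with h | rfl | h
  · exact key h hi hj
  · rw [psi_vec_of_notMem hi, map_smul, psi_vec_of_mem (Or.inl rfl), smul_zero, neg_zero]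
  · rw [key h hj hi, neg_neg]

theorem psiStar_mul_psiStar (i j : ℤ) :
    psiStar K i * psiStar K j = -(psiStar K j * psiStar K i) := by
  refine LinearMap.ext fun v => ext_pairing fun u => ?_
  have h := congrArg (fun A : Module.End K (Fock K) => A u) (psi_mul_psi j i)
  simp only [Module.End.mul_apply, LinearMap.neg_apply] at h
  rw [Module.End.mul_apply, ← pairing_psi, ← pairing_psi, h, LinearMap.neg_apply,
    Module.End.mul_apply, map_neg, map_neg, LinearMap.neg_apply, pairing_psi, pairing_psi]

theorem psiStar_mul_psi (i j : ℤ) :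
    psiStar K j * psi K i = (if i = j then 1 else 0) - psi K i * psiStar K j := by
  refine end_ext_vec fun S => ?_
  rw [LinearMap.sub_apply, Module.End.mul_apply, Module.End.mul_apply]
  rcases eq_or_ne i j with rfl | hij
  · rw [if_pos rfl, Module.End.one_apply]
    by_cases hi : i ∈ S.1
    · have hi' : i ∉ (S.erase i).1 := fun h => h.2 rfl
      rw [psi_vec_of_mem hi, map_zero, psiStar_vec_of_mem hi, map_smul, psi_vec_of_notMem hi',
        Maya.insert_erase hi, smul_smul, Maya.sign_erase hi i, if_neg (lt_irrefl i), mul_one,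
        ← Int.cast_mul, Maya.sign_mul_self]
      simp
    · have he : (S.insert i).erase i = S := by
        apply Maya.ext
        intro l
        rw [Maya.mem_erase, Maya.mem_insert]
        refine ⟨fun hl => hl.1.resolve_left hl.2, fun hl => ⟨Or.inr hl, ?_⟩⟩
        rintro rfl
        exact hi hl
      rw [psi_vec_of_notMem hi, map_smul, psiStar_vec_of_notMem hi,
        psiStar_vec_of_mem (S := S.insert i) (Or.inl rfl), he, Maya.sign_insert hi,
        if_neg (lt_irrefl i), mul_one, smul_smul, ← Int.cast_mul, Maya.sign_mul_self]
      simp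
  · rw [if_neg hij, LinearMap.zero_apply, zero_sub]
    by_cases hj : j ∈ S.1
    · rw [psiStar_vec_of_mem hj, map_smul]
      by_cases hi : i ∈ S.1
      · rw [psi_vec_of_mem hi, psi_vec_of_mem (S := S.erase j) ⟨hi, hij⟩]
        simp
      · have hi' : i ∉ (S.erase j).1 := fun h => hi h.1
        have he : (S.insert i).erase j = (S.erase j).insert i := by
          apply Maya.ext
          intro l
          simp only [Maya.mem_erase, Maya.mem_insert]
          constructor
          · tauto
          · rintro (rfl | h)
            · exact ⟨Or.inl rfl, hij⟩
            · tauto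
        rw [psi_vec_of_notMem hi, map_smul, psi_vec_of_notMem hi',
          psiStar_vec_of_mem (S := S.insert i) (Or.inr hj), he, Maya.sign_insert hi,
          Maya.sign_erase hj i, smul_smul, smul_smul, ← neg_smul]
        congr 1
        push_cast
        rcases lt_or_gt_of_ne hij with h | h
        · rw [if_pos h, if_neg h.not_gt]
          ring
        · rw [if_pos h, if_neg h.not_gt]
          ring
    · rw [psiStar_vec_of_notMem hj, map_zero, neg_zero]
      by_cases hi : i ∈ S.1
      · rw [psi_vec_of_mem hi, map_zero]
      · rw [psi_vec_of_notMem hi, map_smul,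
          psiStar_vec_of_notMem (S := S.insert i)
            (fun h => (Maya.mem_insert.1 h).elim (fun h => hij h.symm) hj), smul_zero]

/-- Normal ordering subtracts the vacuum expectation. -/
theorem normalPair_apply (i j : ℤ) (v : Fock K) :
    normalPair K i j v = psi K i (psiStar K j v) - if i = j ∧ j < 0 then v else 0 := by
  have h := congrArg (fun A : Module.End K (Fock K) => A v) (psiStar_mul_psi (K := K) i j)
  simp only [Module.End.mul_apply, LinearMap.sub_apply] at h
  rw [normalPair]
  split_ifs with h0 h1 h1
  · omega
  · rw [sub_zero, Module.End.mul_apply]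
  · rw [LinearMap.neg_apply, Module.End.mul_apply, h, if_pos h1.1, neg_sub, Module.End.one_apply]
  · rw [LinearMap.neg_apply, Module.End.mul_apply, h, if_neg (by omega), LinearMap.zero_apply,
      zero_sub, neg_neg, sub_zero]

theorem pairing_normalPair (i j : ℤ) (u v : Fock K) :
    pairing (normalPair K i j u) v = pairing u (normalPair K j i v) := by
  have hc : (i = j ∧ j < 0) ↔ (j = i ∧ i < 0) := by
    constructor <;> (rintro ⟨rfl, h⟩; exact ⟨rfl, h⟩)
  rw [normalPair_apply, normalPair_apply, map_sub, map_sub, LinearMap.sub_apply, pairing_psi,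
    pairing_psiStar]
  simp only [hc]
  split_ifs <;> simp

theorem normalPair_vec_of_ne {i j : ℤ} (hij : i ≠ j) (S : Maya) :
    normalPair K i j (vec K S) = psi K i (psiStar K j (vec K S)) := by
  rw [normalPair_apply, if_neg (fun h => hij h.1), sub_zero]

open Classical in
theorem normalPair_self_vec (j : ℤ) (S : Maya) :
    normalPair K j j (vec K S) =
      ((if j ∈ S.1 then 1 else 0) - if j < 0 then 1 else 0 : K) • vec K S := by
  have h : psi K j (psiStar K j (vec K S)) = (if j ∈ S.1 then 1 else 0 : K) • vec K S := by
    split_ifs with hj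
    · have hj' : j ∉ (S.erase j).1 := fun h => h.2 rfl
      rw [psiStar_vec_of_mem hj, map_smul, psi_vec_of_notMem hj', Maya.insert_erase hj, smul_smul,
        Maya.sign_erase hj j, if_neg (lt_irrefl j), mul_one, ← Int.cast_mul, Maya.sign_mul_self]
      simp
    · rw [psiStar_vec_of_notMem hj, map_zero, zero_smul]
  rw [normalPair_apply, h, sub_smul]
  simp only [true_and]
  split_ifs <;> simp

/-- If `v_T` occurs in `ψ_i ψ_j^* v_S` and `i ≠ j` then `i ∈ T ∖ S` and `j ∈ S ∖ T`. -/
theorem mem_of_normalPair_ne_zero {i j : ℤ} (hij : i ≠ j) {S T : Maya}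
    (h : normalPair K i j (vec K S) T ≠ 0) :
    (i ∈ T.1 ∧ i ∉ S.1) ∧ (j ∈ S.1 ∧ j ∉ T.1) := by
  classical
  rw [normalPair_vec_of_ne hij] at h
  by_cases hj : j ∈ S.1
  · by_cases hi : i ∈ S.1
    · rw [psiStar_vec_of_mem hj, map_smul, psi_vec_of_mem (S := S.erase j) ⟨hi, hij⟩] at h
      simp at h
    · rw [psiStar_vec_of_mem hj, map_smul, psi_vec_of_notMem (S := S.erase j)
        (fun h => hi h.1), smul_smul, Finsupp.smul_apply, vec, Finsupp.single_apply] at h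
      split_ifs at h with hT
      · subst hT
        refine ⟨⟨Or.inl rfl, hi⟩, hj, ?_⟩
        rintro (rfl | h)
        · exact hij rfl
        · exact h.2 rfl
      · simp at h
  · rw [psiStar_vec_of_notMem hj] at h
    simp at h

theorem finite_normalPair (T S : Maya) :
    {p : ℤ × ℤ | normalPair K p.1 p.2 (vec K S) T ≠ 0}.Finite := by
  have hd : ((fun j : ℤ => (j, j)) '' (S.1 ∩ Set.Ici 0 ∪ Set.Iio 0 \ S.1)).Finite :=
    (S.2.1.union S.2.2).image _
  refine (((T.finite_diff S).prod (S.finite_diff T)).union hd).subset ?_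
  rintro ⟨i, j⟩ h
  rcases eq_or_ne i j with rfl | hij
  · refine Or.inr ⟨i, ?_, rfl⟩
    by_contra hi
    apply h
    simp only [Set.mem_union, Set.mem_inter_iff, Set.mem_Ici, Set.mem_sdiff, Set.mem_Iio] at hi
    change normalPair K i i (vec K S) T = 0
    rw [normalPair_self_vec]
    by_cases h1 : i ∈ S.1 <;> by_cases h2 : i < 0
    · simp [h1, h2]
    · exact absurd (Or.inl ⟨h1, not_lt.1 h2⟩) hi
    · exact absurd (Or.inr ⟨h2, h1⟩) hi
    · simp [h1, h2]
  · exact Or.inl (mem_of_normalPair_ne_zero hij h)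

end Fermions

/-! ### The Heisenberg algebra -/

section Heisenberg

open Filter

variable {K : Type*} [Field K]

theorem finite_normalPair_shift (n : ℤ) (S : Maya) :
    {k : ℤ | normalPair K (k - n) k (vec K S) ≠ 0}.Finite := by
  obtain ⟨a, ha⟩ := S.exists_lower
  obtain ⟨b, hb⟩ := S.exists_upper
  refine (Set.finite_Icc (min a (min (a + n) 0)) (max b 0)).subset fun k hk => ?_
  by_contra h
  apply hk
  rw [Set.mem_Icc, not_and_or, not_le, not_le, lt_min_iff, lt_min_iff, max_lt_iff] at h
  rcases h with ⟨h1, h2, h3⟩ | ⟨h1, h2⟩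
  · rcases eq_or_ne n 0 with rfl | hn
    · rw [sub_zero, normalPair_self_vec, if_pos (ha k h1), if_pos h3, sub_self, zero_smul]
    · have hk1 : k - n ∈ (S.erase k).1 := ⟨ha _ (by omega), by simpa using hn⟩
      rw [normalPair_vec_of_ne (by omega), psiStar_vec_of_mem (ha k h1), map_smul,
        psi_vec_of_mem hk1, smul_zero]
  · have hk1 : k ∉ S.1 := fun h => absurd (hb k h) h1.not_gt
    rw [normalPair_apply, psiStar_vec_of_notMem hk1, map_zero, if_neg (by omega), sub_zero]

theorem alpha_vec (n : ℤ) (S : Maya) :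
    alpha K n (vec K S) = ∑ᶠ k : ℤ, normalPair K (k - n) k (vec K S) := by
  rw [alpha]
  nth_rewrite 1 [vec]
  rw [Finsupp.linearCombination_single, one_smul]

/-- The sum defining `α_n` is locally finite: on a given vector, `α_n` is the sum over any
sufficiently large finite set of indices. -/
theorem alpha_eventually (n : ℤ) (v : Fock K) :
    ∀ᶠ J : Finset ℤ in atTop, alpha K n v = ∑ j ∈ J, normalPair K (j - n) j v := by
  induction v using vec_induction with
  | h0 => simp
  | hadd u v hu hv =>
    filter_upwards [hu, hv] with J h1 h2
    simp only [map_add, Finset.sum_add_distrib, h1, h2]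
  | hsmul c S h =>
    filter_upwards [h] with J h1
    simp only [map_smul, ← Finset.smul_sum, h1]
  | hvec S =>
    filter_upwards [eventually_ge_atTop (finite_normalPair_shift (K := K) n S).toFinset] with J hJ
    rw [alpha_vec]
    refine finsum_eq_sum_of_support_subset _ fun k hk => hJ ?_
    simpa using hk

theorem eventually_mem_finset (k : ℤ) : ∀ᶠ J : Finset ℤ in atTop, k ∈ J := by
  filter_upwards [eventually_ge_atTop {k}] with J hJ
  exact hJ (Finset.mem_singleton_self k)

theorem alpha_psi (n k : ℤ) (v : Fock K) :
    alpha K n (psi K k v) = psi K k (alpha K n v) + psi K (k - n) v := by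
  obtain ⟨J, h1, h2, hk⟩ := ((alpha_eventually n (psi K k v)).and
    ((alpha_eventually n v).and (eventually_mem_finset k))).exists
  rw [h1, h2, map_sum, ← sub_eq_iff_eq_add', ← Finset.sum_sub_distrib,
    Finset.sum_eq_single_of_mem k hk]
  · have h3 := congrArg (fun A : Module.End K (Fock K) => A v) (psiStar_mul_psi (K := K) k k)
    have h4 := congrArg (fun A : Module.End K (Fock K) => A (psiStar K k v))
      (psi_mul_psi (K := K) (k - n) k)
    simp only [Module.End.mul_apply, LinearMap.sub_apply, if_true, Module.End.one_apply,
      LinearMap.neg_apply] at h3 h4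
    rw [normalPair_apply, normalPair_apply, h3, map_sub, map_sub, h4]
    split_ifs <;> simp
  · intro j _ hj
    have h3 := congrArg (fun A : Module.End K (Fock K) => A v) (psiStar_mul_psi (K := K) k j)
    have h4 := congrArg (fun A : Module.End K (Fock K) => A (psiStar K j v))
      (psi_mul_psi (K := K) (j - n) k)
    simp only [Module.End.mul_apply, LinearMap.sub_apply, if_neg (Ne.symm hj),
      LinearMap.zero_apply, LinearMap.neg_apply] at h3 h4
    rw [normalPair_apply, normalPair_apply, h3, map_sub, map_sub, h4]
    split_ifs <;> simp

theorem alpha_psiStar (n k : ℤ) (v : Fock K) :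
    alpha K n (psiStar K k v) = psiStar K k (alpha K n v) - psiStar K (k + n) v := by
  obtain ⟨J, h1, h2, hk⟩ := ((alpha_eventually n (psiStar K k v)).and
    ((alpha_eventually n v).and (eventually_mem_finset (k + n)))).exists
  have h3 : ∀ j, psi K (j - n) (psiStar K j (psiStar K k v)) =
      psiStar K k (psi K (j - n) (psiStar K j v)) -
        if j = k + n then psiStar K j v else 0 := by
    intro j
    have h3 := congrArg (fun A : Module.End K (Fock K) => A v) (psiStar_mul_psiStar (K := K) j k)
    have h4 := congrArg (fun A : Module.End K (Fock K) => A (psiStar K j v))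
      (psiStar_mul_psi (K := K) (j - n) k)
    simp only [Module.End.mul_apply, LinearMap.sub_apply, LinearMap.neg_apply] at h3 h4
    rw [h3, h4, map_neg]
    by_cases h : j = k + n
    · rw [if_pos h, if_pos (by omega), Module.End.one_apply]
      abel
    · rw [if_neg h, if_neg (by omega), LinearMap.zero_apply]
      abel
  have h5 : ∀ j, normalPair K (j - n) j (psiStar K k v) =
      psiStar K k (normalPair K (j - n) j v) - if j = k + n then psiStar K j v else 0 := by
    intro j
    have h6 : psiStar K k (if j - n = j ∧ j < 0 then v else 0) =
        if j - n = j ∧ j < 0 then psiStar K k v else 0 := by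
      split_ifs <;> simp
    rw [normalPair_apply, normalPair_apply, h3, map_sub, h6]
    abel
  rw [h1, h2, map_sum, Finset.sum_congr rfl fun j _ => h5 j, Finset.sum_sub_distrib,
    Finset.sum_ite_eq' J (k + n), if_pos hk]

/-- The commutator of `α_m` and `ψ_i ψ_j^*`, with the Schwinger term produced by normal
ordering. -/
theorem alpha_normalPair (m i j : ℤ) (v : Fock K) :
    alpha K m (normalPair K i j v) = normalPair K i j (alpha K m v) +
      (normalPair K (i - m) j v - normalPair K i (j + m) v) +
      if i = j + m then ((if j < 0 then 1 else 0) - (if j + m < 0 then 1 else 0) : K) • v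
        else 0 := by
  have h1 : i - m = j ↔ i = j + m := by omega
  have h2 : alpha K m (if i = j ∧ j < 0 then v else 0) =
      if i = j ∧ j < 0 then alpha K m v else 0 := by
    split_ifs <;> simp
  simp only [normalPair_apply, map_sub, alpha_psi, alpha_psiStar, h1, h2]
  by_cases h : i = j + m
  · simp only [h, true_and, if_true]
    split_ifs <;> module
  · simp only [h, false_and, if_false]
    module

theorem tendsto_map_shift (m : ℤ) :
    Tendsto (fun J : Finset ℤ => J.map (addRightEmbedding m)) atTop atTop := by
  refine tendsto_atTop_mono' atTop (f₁ := fun J : Finset ℤ => J.map (addRightEmbedding m))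
    (Eventually.of_forall fun J => le_rfl) ?_
  refine tendsto_atTop.2 fun I => ?_
  filter_upwards [eventually_ge_atTop (I.map (addRightEmbedding (-m)))] with J hJ
  intro i hi
  refine Finset.mem_map.2 ⟨i - m, hJ (Finset.mem_map.2 ⟨i, hi, ?_⟩), ?_⟩ <;> simp
  omega

theorem sum_step_eventually (m : ℤ) : ∀ᶠ J : Finset ℤ in atTop,
    ∑ j ∈ J, ((if j < 0 then 1 else 0) - (if j + m < 0 then 1 else 0) : ℤ) = m := by
  filter_upwards [eventually_ge_atTop (Finset.Ico (-|m|) |m|)] with J hJ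
  have h0 : ∑ j ∈ J, ((if j < 0 then 1 else 0) - (if j + m < 0 then 1 else 0) : ℤ) =
      ∑ j ∈ Finset.Ico (-|m|) |m|, ((if j < 0 then 1 else 0) - (if j + m < 0 then 1 else 0)) := by
    refine (Finset.sum_subset hJ fun j _ hj => ?_).symm
    rw [Finset.mem_Ico, not_and_or, not_le, not_lt] at hj
    have := le_abs_self m
    have := neg_abs_le m
    split_ifs <;> omega
  rw [h0]
  rcases le_total 0 m with hm | hm
  · have h1 : ∀ j ∈ Finset.Ico (-|m|) |m|,
        ((if j < 0 then 1 else 0) - (if j + m < 0 then 1 else 0) : ℤ) =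
          if j ∈ Finset.Ico (-m) 0 then 1 else 0 := by
      intro j _
      simp only [Finset.mem_Ico]
      split_ifs <;> omega
    rw [Finset.sum_congr rfl h1, Finset.sum_ite_mem, Finset.sum_const, abs_of_nonneg hm,
      Finset.Ico_inter_Ico]
    simp [hm]
  · have h1 : ∀ j ∈ Finset.Ico (-|m|) |m|,
        ((if j < 0 then 1 else 0) - (if j + m < 0 then 1 else 0) : ℤ) =
          if j ∈ Finset.Ico 0 (-m) then -1 else 0 := by
      intro j _
      simp only [Finset.mem_Ico]
      split_ifs <;> omega
    rw [Finset.sum_congr rfl h1, Finset.sum_ite_mem, Finset.sum_const, abs_of_nonpos hm,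
      Finset.Ico_inter_Ico]
    simp [hm]

/-- The Heisenberg commutation relations. -/
theorem alpha_alpha (m n : ℤ) (v : Fock K) :
    alpha K m (alpha K n v) = alpha K n (alpha K m v) +
      if m + n = 0 then (m : K) • v else 0 := by
  obtain ⟨J, h1, h2, h3, h4, h5⟩ := ((alpha_eventually n v).and
    ((alpha_eventually n (alpha K m v)).and ((alpha_eventually (n + m) v).and
    (((tendsto_map_shift m).eventually (alpha_eventually (n + m) v)).and
    (sum_step_eventually m))))).exists
  rw [h1, h2, map_sum]
  simp only [alpha_normalPair]
  rw [Finset.sum_add_distrib, Finset.sum_add_distrib, Finset.sum_sub_distrib]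
  rw [Finset.sum_map] at h4
  have h6 : ∑ j ∈ J, normalPair K (j - n - m) j v = ∑ j ∈ J, normalPair K (j - n) (j + m) v := by
    rw [h3] at h4
    refine Eq.trans (Finset.sum_congr rfl fun j _ => ?_)
      (h4.trans (Finset.sum_congr rfl fun j _ => ?_))
    · rw [sub_sub]
    · rw [addRightEmbedding_apply, add_sub_add_right_eq_sub]
  rw [h6, sub_self, add_zero]
  congr 1
  by_cases h : m + n = 0
  · rw [if_pos h, show (m : K) = ((∑ j ∈ J, ((if j < 0 then 1 else 0) -
      (if j + m < 0 then 1 else 0) : ℤ) : ℤ) : K) by rw [h5], Int.cast_sum, Finset.sum_smul]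
    refine Finset.sum_congr rfl fun j _ => ?_
    rw [if_pos (by omega)]
    push_cast
    rfl
  · rw [if_neg h]
    exact Finset.sum_eq_zero fun j _ => if_neg (by omega)

theorem pairing_alpha (n : ℤ) (u v : Fock K) :
    pairing (alpha K n u) v = pairing u (alpha K (-n) v) := by
  obtain ⟨J, h1, h2⟩ := ((alpha_eventually n u).and
    ((tendsto_map_shift (-n)).eventually (alpha_eventually (-n) v))).exists
  rw [h1, h2, map_sum, map_sum, Finset.sum_map, LinearMap.sum_apply]
  refine Finset.sum_congr rfl fun j _ => ?_
  rw [pairing_normalPair, addRightEmbedding_apply]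
  congr 3
  ring

/-- `α_0` is the charge. -/
theorem alpha_zero_vec (S : Maya) : alpha K 0 (vec K S) = (S.charge : K) • vec K S := by
  classical
  obtain ⟨J, h1, h2⟩ := ((alpha_eventually 0 (vec K S)).and (eventually_ge_atTop
    (S.2.1.toFinset ∪ S.2.2.toFinset))).exists
  rw [h1]
  simp only [sub_zero, normalPair_self_vec]
  rw [← Finset.sum_smul]
  congr 1
  have h3 : ∀ j : ℤ, ((if j ∈ S.1 then 1 else 0) - (if j < 0 then 1 else 0) : K) =
      (if j ∈ S.2.1.toFinset then 1 else 0) - (if j ∈ S.2.2.toFinset then 1 else 0) := by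
    intro j
    simp only [Set.Finite.mem_toFinset, Set.mem_inter_iff, Set.mem_Ici, Set.mem_sdiff, Set.mem_Iio]
    by_cases h4 : j ∈ S.1 <;> by_cases h5 : j < 0 <;> simp [h4, h5]
  rw [Finset.sum_congr rfl fun j _ => h3 j, Finset.sum_sub_distrib, Finset.sum_ite_mem,
    Finset.sum_ite_mem, Finset.inter_eq_right.2 (Finset.union_subset_left h2),
    Finset.inter_eq_right.2 (Finset.union_subset_right h2), Maya.charge,
    Set.ncard_eq_toFinset_card _ S.2.1, Set.ncard_eq_toFinset_card _ S.2.2]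
  simp

end Heisenberg

/-! ### The energy -/

section Energy

open Filter

/-- The pairs consisting of an empty site and of an occupied site above it. -/
def Maya.inversions (S : Maya) : Set (ℤ × ℤ) := {p | p.1 < p.2 ∧ p.2 ∈ S.1 ∧ p.1 ∉ S.1}

/-- The energy of a configuration relative to the ground state of the same charge: the number of
pairs consisting of an empty site and of an occupied site above it (the size of the partition
attached to `S`). -/
def Maya.energy (S : Maya) : ℕ := S.inversions.ncard

theorem Maya.finite_inversions (S : Maya) : S.inversions.Finite := by
  obtain ⟨a, ha⟩ := S.exists_lower
  obtain ⟨b, hb⟩ := S.exists_upper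
  refine ((Set.finite_Ico a b).prod (Set.finite_Ico a b)).subset ?_
  rintro ⟨i, j⟩ ⟨h1, h2, h3⟩
  have h4 : a ≤ i := not_lt.1 fun h => h3 (ha i h)
  have h5 : j < b := hb j h2
  dsimp only at h1
  exact ⟨⟨h4, h1.trans h5⟩, ⟨h4.trans h1.le, h5⟩⟩

variable {K : Type*} [Field K]

theorem alpha_eventually_psi {n : ℤ} (hn : n ≠ 0) (v : Fock K) :
    ∀ᶠ J : Finset ℤ in atTop, alpha K n v = ∑ j ∈ J, psi K (j - n) (psiStar K j v) := by
  filter_upwards [alpha_eventually n v] with J hJ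
  rw [hJ]
  refine Finset.sum_congr rfl fun j _ => ?_
  rw [normalPair_apply, if_neg (by omega), sub_zero]

theorem psi_psiStar_vec_eq_zero {S : Maya} {i j : ℤ} (hij : i ≠ j) (h : j ∈ S.1 → i ∈ S.1) :
    psi K i (psiStar K j (vec K S)) = 0 := by
  by_cases hj : j ∈ S.1
  · rw [psiStar_vec_of_mem hj, map_smul, psi_vec_of_mem (S := S.erase j) ⟨h hj, hij⟩, smul_zero]
  · rw [psiStar_vec_of_notMem hj, map_zero]

theorem psi_psi_apply (i j : ℤ) (v : Fock K) : psi K i (psi K j v) = -psi K j (psi K i v) :=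
  congrArg (fun A : Module.End K (Fock K) => A v) (psi_mul_psi i j)

theorem psiStar_psiStar_apply (i j : ℤ) (v : Fock K) :
    psiStar K i (psiStar K j v) = -psiStar K j (psiStar K i v) :=
  congrArg (fun A : Module.End K (Fock K) => A v) (psiStar_mul_psiStar i j)

theorem psiStar_psi_apply (i j : ℤ) (v : Fock K) :
    psiStar K j (psi K i v) = (if i = j then v else 0) - psi K i (psiStar K j v) := by
  have h := congrArg (fun A : Module.End K (Fock K) => A v) (psiStar_mul_psi (K := K) i j)
  simp only [Module.End.mul_apply, LinearMap.sub_apply] at h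
  rw [h]
  split_ifs <;> simp

open Classical in
theorem quartic_diagonal (S : Maya) {n j : ℤ} (hn : 0 < n) :
    psi K (j - n + n) (psiStar K (j - n) (psi K (j - n) (psiStar K j (vec K S)))) =
      if (j - n, j) ∈ S.inversions then vec K S else 0 := by
  have hne : j - n ≠ j := by omega
  split_ifs with h
  · obtain ⟨-, h1, h2⟩ := h
    dsimp only at h1 h2
    have h4 : j - n ∉ (S.erase j).1 := fun h => h2 h.1
    rw [psiStar_psi_apply, if_pos rfl, psiStar_vec_of_mem h1, map_smul, psiStar_vec_of_notMem h4,
      smul_zero, map_zero, sub_zero, map_smul, sub_add_cancel, psi_vec_of_notMem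
      (S := S.erase j) (fun h => h.2 rfl), smul_smul, Maya.insert_erase h1, Maya.sign_erase h1 j,
      if_neg (lt_irrefl j), mul_one, ← Int.cast_mul, Maya.sign_mul_self, Int.cast_one, one_smul]
  · rw [psi_psiStar_vec_eq_zero hne, map_zero, map_zero]
    intro h1
    by_contra h2
    exact h ⟨by dsimp only; omega, h1, h2⟩

variable [CharZero K]

theorem eq_zero_of_add_self {v : Fock K} (h : v + v = 0) : v = 0 := by
  rw [← two_smul K, smul_eq_zero] at h
  exact h.resolve_left two_ne_zero

/-- The part of `∑_{n > 0} α_{-n} α_n v_S` in which two different fermions are moved vanishes: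
the two ways to reach a given final configuration have opposite signs. -/
theorem sum_quartic_eq_zero {S : Maya} {a b N : ℤ} (ha : ∀ k, k < a → k ∈ S.1)
    (hb : ∀ k ∈ S.1, k < b) (hN : b - a ≤ N) (J : Finset ℤ) :
    ∑ x ∈ Finset.Ioc 0 N ×ˢ (J ×ˢ J) with x.2.1 ≠ x.2.2 - x.1,
      psi K (x.2.1 + x.1) (psiStar K x.2.1 (psi K (x.2.2 - x.1) (psiStar K x.2.2 (vec K S)))) =
        0 := by
  classical
  set f : ℤ × ℤ × ℤ → Fock K := fun x =>
    psi K (x.2.1 + x.1) (psiStar K x.2.1 (psi K (x.2.2 - x.1) (psiStar K x.2.2 (vec K S))))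
    with hf
  -- `g` exchanges the two final positions if the fermion raised starts below both of them, and
  -- the two initial positions otherwise
  let g : ℤ × ℤ × ℤ → ℤ × ℤ × ℤ := fun x =>
    if x.2.1 < x.2.2 - x.1 then (x.2.2 - x.1 - x.2.1, x.2.1, x.2.2)
    else (x.2.1 + x.1 - x.2.2, x.2.2, x.2.1)
  have hquad : ∀ x : ℤ × ℤ × ℤ, x.2.1 ≠ x.2.2 - x.1 → f x =
      -psi K (x.2.1 + x.1) (psi K (x.2.2 - x.1) (psiStar K x.2.1 (psiStar K x.2.2 (vec K S)))) := by
    intro x hx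
    simp only [hf]
    rw [psiStar_psi_apply, if_neg (Ne.symm hx), zero_sub, map_neg]
  have hbound : ∀ x : ℤ × ℤ × ℤ, 0 < x.1 → f x ≠ 0 → x.1 ≤ N := by
    intro x hx h
    by_contra hlt
    apply h
    simp only [hf]
    rw [psi_psiStar_vec_eq_zero (by omega), map_zero, map_zero]
    intro hj
    have := hb _ hj
    exact ha _ (by omega)
  have hg0 : ∀ x : ℤ × ℤ × ℤ, 0 < x.1 → x.2.1 ≠ x.2.2 - x.1 → 0 < (g x).1 := by
    intro x h1 h2
    simp only [g]
    split_ifs <;> dsimp only <;> omega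
  have hg1 : ∀ x : ℤ × ℤ × ℤ, 0 < x.1 → x.2.1 ≠ x.2.2 - x.1 → (g x).2.1 ≠ (g x).2.2 - (g x).1 := by
    intro x h1 h2
    simp only [g]
    split_ifs <;> dsimp only <;> omega
  have hgg : ∀ x : ℤ × ℤ × ℤ, 0 < x.1 → x.2.1 ≠ x.2.2 - x.1 → g (g x) = x := by
    rintro ⟨n, k, j⟩ h1 h2
    simp only at h1 h2
    simp only [g]
    by_cases h : k < j - n
    · rw [if_pos h]
      dsimp only
      rw [if_pos (by omega)]
      ext <;> dsimp only
      omega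
    · rw [if_neg h]
      dsimp only
      rw [if_neg (by omega)]
      ext <;> dsimp only
      omega
  have hfg : ∀ x : ℤ × ℤ × ℤ, 0 < x.1 → x.2.1 ≠ x.2.2 - x.1 → f x + f (g x) = 0 := by
    intro x h1 h2
    rw [hquad x h2, hquad _ (hg1 x h1 h2)]
    simp only [g]
    split_ifs with h
    · dsimp only
      rw [psi_psi_apply (x.2.1 + x.1), show x.2.1 + (x.2.2 - x.1 - x.2.1) = x.2.2 - x.1 by ring,
        show x.2.2 - (x.2.2 - x.1 - x.2.1) = x.2.1 + x.1 by ring]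
      abel
    · dsimp only
      rw [psiStar_psiStar_apply x.2.1,
        show x.2.2 + (x.2.1 + x.1 - x.2.2) = x.2.1 + x.1 by ring,
        show x.2.1 - (x.2.1 + x.1 - x.2.2) = x.2.2 - x.1 by ring, map_neg, map_neg]
      abel
  rw [← Finset.sum_filter_ne_zero]
  have hmem : ∀ x ∈ Finset.filter (fun x => f x ≠ 0) (Finset.filter
      (fun x : ℤ × ℤ × ℤ => x.2.1 ≠ x.2.2 - x.1) (Finset.Ioc 0 N ×ˢ (J ×ˢ J))),
      (0 < x.1 ∧ x.2.1 ≠ x.2.2 - x.1) ∧ f x ≠ 0 ∧ x.2.1 ∈ J ∧ x.2.2 ∈ J := by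
    intro x hx
    simp only [Finset.mem_filter, Finset.mem_product, Finset.mem_Ioc] at hx
    tauto
  refine Finset.sum_involution (fun x _ => g x) (fun x hx => ?_) (fun x hx h0 h => ?_)
    (fun x hx => ?_) (fun x hx => ?_)
  · obtain ⟨⟨h1, h2⟩, _⟩ := hmem x hx
    exact hfg x h1 h2
  · obtain ⟨⟨h1, h2⟩, _⟩ := hmem x hx
    have h3 := hfg x h1 h2
    rw [h] at h3
    exact h0 (eq_zero_of_add_self h3)
  · obtain ⟨⟨h1, h2⟩, h3, h4, h5⟩ := hmem x hx
    have h6 : f (g x) ≠ 0 := by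
      rw [← neg_eq_of_add_eq_zero_right (hfg x h1 h2)]
      exact neg_ne_zero.2 h3
    have h7 := hg0 x h1 h2
    have h8 : (g x).2.1 ∈ J ∧ (g x).2.2 ∈ J := by
      simp only [g]
      split_ifs
      exacts [⟨h4, h5⟩, ⟨h5, h4⟩]
    simp only [Finset.mem_filter, Finset.mem_product, Finset.mem_Ioc]
    exact ⟨⟨⟨⟨h7, hbound _ h7 h6⟩, h8⟩, hg1 x h1 h2⟩, h6⟩
  · obtain ⟨⟨h1, h2⟩, _⟩ := hmem x hx
    exact hgg x h1 h2

/-- The energy operator is `∑_{n > 0} α_{-n} α_n`. -/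
theorem sum_alpha_alpha_vec (S : Maya) : ∀ᶠ N : ℤ in atTop,
    ∑ n ∈ Finset.Ioc 0 N, alpha K (-n) (alpha K n (vec K S)) = (S.energy : K) • vec K S := by
  classical
  obtain ⟨a, ha⟩ := S.exists_lower
  obtain ⟨b, hb⟩ := S.exists_upper
  filter_upwards [eventually_ge_atTop (b - a)] with N hN
  have hJ : ∀ᶠ J : Finset ℤ in atTop, ∀ n ∈ Finset.Ioc 0 N,
      alpha K n (vec K S) = ∑ j ∈ J, psi K (j - n) (psiStar K j (vec K S)) ∧
      alpha K (-n) (alpha K n (vec K S)) =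
        ∑ k ∈ J, psi K (k - -n) (psiStar K k (alpha K n (vec K S))) := by
    rw [Filter.eventually_all_finset]
    intro n hn
    have hn0 := (Finset.mem_Ioc.1 hn).1
    exact (alpha_eventually_psi (by omega) _).and (alpha_eventually_psi (by omega) _)
  obtain ⟨J, h1, h2⟩ := (hJ.and (eventually_ge_atTop (Finset.Ico a b))).exists
  have h3 : ∑ n ∈ Finset.Ioc 0 N, alpha K (-n) (alpha K n (vec K S)) =
      ∑ x ∈ Finset.Ioc 0 N ×ˢ (J ×ˢ J), psi K (x.2.1 + x.1)
        (psiStar K x.2.1 (psi K (x.2.2 - x.1) (psiStar K x.2.2 (vec K S)))) := by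
    rw [Finset.sum_product]
    refine Finset.sum_congr rfl fun n hn => ?_
    obtain ⟨h4, h5⟩ := h1 n hn
    rw [h5, h4, Finset.sum_product]
    simp only [map_sum, sub_neg_eq_add]
  rw [h3, ← Finset.sum_filter_add_sum_filter_not _ (fun x : ℤ × ℤ × ℤ => x.2.1 ≠ x.2.2 - x.1),
    sum_quartic_eq_zero ha hb hN J, zero_add]
  have h4 : ∀ x ∈ Finset.filter (fun x : ℤ × ℤ × ℤ => ¬x.2.1 ≠ x.2.2 - x.1)
      (Finset.Ioc 0 N ×ˢ (J ×ˢ J)),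
      psi K (x.2.1 + x.1) (psiStar K x.2.1 (psi K (x.2.2 - x.1) (psiStar K x.2.2 (vec K S)))) =
        if (x.2.2 - x.1, x.2.2) ∈ S.inversions then vec K S else 0 := by
    rintro ⟨n, k, j⟩ hx
    simp only [Finset.mem_filter, Finset.mem_product, Finset.mem_Ioc, not_not] at hx
    obtain ⟨⟨⟨hn, -⟩, -⟩, rfl⟩ := hx
    exact quartic_diagonal S hn
  rw [Finset.sum_congr rfl h4, ← Finset.sum_filter, Finset.sum_const, ← Nat.cast_smul_eq_nsmul K]
  congr 2
  rw [Maya.energy, Set.ncard_eq_toFinset_card _ S.finite_inversions]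
  refine Finset.card_bij' (fun x _ => (x.2.2 - x.1, x.2.2)) (fun p _ => (p.2 - p.1, p.1, p.2))
    ?_ ?_ ?_ ?_
  · intro x hx
    rw [Finset.mem_filter] at hx
    simpa using hx.2
  · rintro ⟨i, j⟩ hp
    rw [Set.Finite.mem_toFinset] at hp
    have hp' := hp
    obtain ⟨h5, h6, h7⟩ := hp'
    dsimp only at h5 h6 h7
    have h8 : a ≤ i := not_lt.1 fun h => h7 (ha i h)
    have h9 : j < b := hb j h6
    simp only [Finset.mem_filter, Finset.mem_product, Finset.mem_Ioc, not_not, sub_sub_cancel]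
    exact ⟨⟨⟨⟨by omega, by omega⟩, h2 (Finset.mem_Ico.2 ⟨h8, h5.trans h9⟩),
      h2 (Finset.mem_Ico.2 ⟨h8.trans h5.le, h9⟩)⟩, trivial⟩, hp⟩
  · rintro ⟨n, k, j⟩ hx
    simp only [Finset.mem_filter, not_not] at hx
    obtain ⟨⟨-, rfl⟩, -⟩ := hx
    simp
  · rintro ⟨i, j⟩ _
    simp

end Energy

/-! ### Forms with prescribed Heisenberg commutators are determined by ground states -/

section Uniqueness

open Filter

/-- A configuration of energy zero is a ground state. -/
theorem Maya.exists_of_energy_eq_zero {S : Maya} (h : S.energy = 0) :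
    ∃ c : ℤ, ∀ k, k ∈ S.1 ↔ k < c := by
  obtain ⟨a, ha⟩ := S.exists_lower
  obtain ⟨b, hb⟩ := S.exists_upper
  have h0 : S.inversions = ∅ := (Set.ncard_eq_zero S.finite_inversions).1 h
  obtain ⟨m, hm, hmax⟩ := Int.exists_greatest_of_bdd (P := fun k => k ∈ S.1)
    ⟨b, fun z hz => (hb z hz).le⟩ ⟨a - 1, ha _ (by omega)⟩
  refine ⟨m + 1, fun k => ⟨fun hk => Int.lt_add_one_iff.2 (hmax k hk), fun hk => ?_⟩⟩
  by_contra hkS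
  have hkm : k ≠ m := fun h => hkS (h ▸ hm)
  have h1 : (k, m) ∈ S.inversions := ⟨by dsimp only; omega, hm, hkS⟩
  rw [h0] at h1
  exact h1

theorem Maya.charge_of_forall {S : Maya} {c : ℤ} (h : ∀ k, k ∈ S.1 ↔ k < c) : S.charge = c := by
  have hS : S.1 = Set.Iio c := Set.ext h
  have h1 : S.1 ∩ Set.Ici 0 = ((Finset.Ico 0 c : Finset ℤ) : Set ℤ) := by
    ext k
    simp [hS, and_comm]
  have h2 : Set.Iio 0 \ S.1 = ((Finset.Ico c 0 : Finset ℤ) : Set ℤ) := by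
    ext k
    simp [hS]
  rw [charge, h1, h2, Set.ncard_coe_finset, Set.ncard_coe_finset, Int.card_Ico, Int.card_Ico]
  omega

variable {K : Type*} [Field K]

theorem eq_zero_of_vec {M : Type*} [AddCommGroup M] [Module K M] (f : Fock K →ₗ[K] M)
    {v : Fock K} (h : ∀ S, v S ≠ 0 → f (vec K S) = 0) : f v = 0 := by
  rw [← Finsupp.sum_single v, map_finsuppSum]
  refine Finset.sum_eq_zero fun S hS => ?_
  have h1 : (Finsupp.single S (v S) : Fock K) = v S • vec K S := by simp [vec]
  change f (Finsupp.single S (v S)) = 0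
  rw [h1, map_smul, h S (Finsupp.mem_support_iff.1 hS), smul_zero]

/-- The commutator of the energy operator `∑_{m > 0} α_{-m} α_m` with `α_n` is `-n α_n`. -/
theorem energy_operator_alpha (n : ℤ) (v : Fock K) : ∀ᶠ N : ℤ in atTop,
    ∑ m ∈ Finset.Ioc 0 N, alpha K (-m) (alpha K m (alpha K n v)) =
      alpha K n (∑ m ∈ Finset.Ioc 0 N, alpha K (-m) (alpha K m v)) - (n : K) • alpha K n v := by
  filter_upwards [eventually_ge_atTop |n|] with N hN
  have h1 : ∀ m, alpha K (-m) (alpha K m (alpha K n v)) =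
      alpha K n (alpha K (-m) (alpha K m v)) +
        ((if m = n then -((m : K) • alpha K m v) else 0) +
          if m = -n then (m : K) • alpha K (-m) v else 0) := by
    intro m
    rw [alpha_alpha m n v, map_add, alpha_alpha (-m) n, add_assoc]
    congr 2
    · by_cases h : m = n
      · rw [if_pos h, if_pos (by omega)]
        simp
      · rw [if_neg h, if_neg (by omega)]
    · by_cases h : m = -n
      · rw [if_pos h, if_pos (by omega), map_smul]
      · rw [if_neg h, if_neg (by omega), map_zero]
  simp only [h1]
  rw [Finset.sum_add_distrib, ← map_sum, sub_eq_add_neg]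
  congr 1
  rw [Finset.sum_add_distrib, Finset.sum_ite_eq', Finset.sum_ite_eq']
  simp only [Finset.mem_Ioc]
  have := le_abs_self n
  have := neg_abs_le n
  rcases lt_trichotomy n 0 with h | h | h
  · rw [if_neg (by omega), if_pos (by omega), zero_add, neg_neg]
    simp
  · rw [if_neg (by omega), if_neg (by omega), h]
    simp
  · rw [if_pos (by omega), if_neg (by omega), add_zero]

variable [CharZero K]

theorem energy_operator_apply (v : Fock K) : ∀ᶠ N : ℤ in atTop, ∀ T : Maya,
    (∑ n ∈ Finset.Ioc 0 N, alpha K (-n) (alpha K n v)) T = T.energy * v T := by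
  induction v using vec_induction with
  | h0 => simp
  | hadd u v hu hv =>
    filter_upwards [hu, hv] with N h1 h2 T
    simp only [map_add, Finset.sum_add_distrib]
    rw [Finsupp.add_apply, h1, h2, Finsupp.add_apply, mul_add]
  | hsmul c S h =>
    filter_upwards [h] with N h1 T
    simp only [map_smul, ← Finset.smul_sum]
    rw [Finsupp.smul_apply, h1, Finsupp.smul_apply, smul_eq_mul, smul_eq_mul]
    ring
  | hvec S =>
    classical
    filter_upwards [sum_alpha_alpha_vec (K := K) S] with N hN T
    rw [hN, Finsupp.smul_apply, vec, Finsupp.single_apply]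
    split_ifs with h
    · rw [h, smul_eq_mul]
    · simp

/-- The matrix coefficients of `α_n` vanish unless the energy drops by exactly `n`. -/
theorem energy_of_alpha_ne_zero {n : ℤ} {S T : Maya} (h : alpha K n (vec K S) T ≠ 0) :
    (T.energy : ℤ) = S.energy - n := by
  obtain ⟨N, h1, h2, h3⟩ := ((energy_operator_alpha n (vec K S)).and
    ((energy_operator_apply (alpha K n (vec K S))).and (sum_alpha_alpha_vec (K := K) S))).exists
  have h4 := h2 T
  rw [h1, h3, map_smul, Finsupp.sub_apply, Finsupp.smul_apply, Finsupp.smul_apply, smul_eq_mul,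
    smul_eq_mul, ← sub_mul] at h4
  have h5 := mul_right_cancel₀ h h4
  have h6 : ((S.energy - n : ℤ) : K) = ((T.energy : ℤ) : K) := by
    push_cast
    exact h5
  exact (Int.cast_injective h6).symm

theorem charge_of_alpha_ne_zero {n : ℤ} {S T : Maya} (h : alpha K n (vec K S) T ≠ 0) :
    T.charge = S.charge := by
  have h0 : ∀ v : Fock K, (alpha K 0 v) T = T.charge * v T := by
    intro v
    rw [← pairing_vec, ← neg_zero, ← pairing_alpha, alpha_zero_vec, map_smul,
      LinearMap.smul_apply, pairing_vec, smul_eq_mul]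
  have h1 := alpha_alpha 0 n (vec K S)
  rw [Int.cast_zero, zero_smul, ite_self, add_zero, alpha_zero_vec, map_smul] at h1
  have h2 := congrArg (fun v : Fock K => v T) h1
  rw [h0, Finsupp.smul_apply, smul_eq_mul] at h2
  exact Int.cast_injective (mul_right_cancel₀ h h2)

variable {F : Type*} [Field F] [Algebra K F]

/-- A form with `B(α_{-n} u, v) - B(u, α_n v) = c_n B(u, v)` for all `n` is determined in each
charge by its value on the ground state: the energy operator `∑_{n > 0} α_{-n} α_n` lowers the
energies of the arguments. -/
theorem form_eq_zero (B : Fock K →ₗ[K] Fock K →ₗ[K] F) {c : ℤ → F} (hc : c 0 = 0)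
    (hB : ∀ n u v, B (alpha K (-n) u) v - B u (alpha K n v) = c n * B u v) {q : ℤ}
    (hvac : ∀ S : Maya, S.energy = 0 → S.charge = q → B (vec K S) (vec K S) = 0) :
    ∀ T S : Maya, S.charge = q → B (vec K T) (vec K S) = 0 := by
  have main : ∀ (m : ℕ) (T S : Maya), T.energy + S.energy = m → S.charge = q →
      B (vec K T) (vec K S) = 0 := by
    intro m
    induction m using Nat.strong_induction_on with
    | _ m ih =>
    intro T S hm hq
    by_cases hTS : T.charge = S.charge
    swap
    -- for `n = 0` the relation says that the form preserves the charge
    · have h1 := hB 0 (vec K T) (vec K S)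
      rw [neg_zero, alpha_zero_vec, alpha_zero_vec, map_smul, map_smul, LinearMap.smul_apply, hc,
        zero_mul, ← sub_smul, smul_eq_zero] at h1
      refine h1.resolve_left fun h2 => hTS ?_
      exact Int.cast_injective (sub_eq_zero.1 h2)
    have hvv : ∀ u v : Fock K, (∀ T' S', u T' ≠ 0 → v S' ≠ 0 →
        T'.energy + S'.energy < m ∧ S'.charge = q) → B u v = 0 := by
      intro u v h
      refine eq_zero_of_vec (B u) fun S' hS' => ?_
      rw [← LinearMap.flip_apply]
      refine eq_zero_of_vec (B.flip (vec K S')) fun T' hT' => ?_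
      obtain ⟨h1, h2⟩ := h T' S' hT' hS'
      exact ih _ h1 T' S' rfl h2
    have hself : ∀ {S T : Maya}, vec K S T ≠ 0 → T = S := by
      classical
      intro S T h
      rw [vec, Finsupp.single_apply] at h
      by_contra hne
      exact h (if_neg (Ne.symm hne))
    have hlow : ∀ {n : ℤ} {S T : Maya}, 0 < n → alpha K n (vec K S) T ≠ 0 →
        T.energy < S.energy := by
      intro n S T hn h
      have := energy_of_alpha_ne_zero h
      omega
    have h2 : ∀ n, 0 < n → B (alpha K n (vec K T)) (alpha K n (vec K S)) = 0 := by
      intro n hn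
      refine hvv _ _ fun T' S' hT' hS' => ⟨?_, (charge_of_alpha_ne_zero hS').trans hq⟩
      have := hlow hn hT'
      have := hlow hn hS'
      omega
    by_cases hS : S.energy = 0
    · by_cases hT : T.energy = 0
      · obtain ⟨k, hk⟩ := Maya.exists_of_energy_eq_zero hS
        obtain ⟨l, hl⟩ := Maya.exists_of_energy_eq_zero hT
        rw [Maya.charge_of_forall hk, Maya.charge_of_forall hl] at hTS
        have : T = S := Maya.ext fun i => by rw [hl, hk, hTS]
        rw [this]
        exact hvac S hS hq
      -- in `B(α_{-n} α_n v_T, v_S)` the factor `α_{-n}` is moved to the second argument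
      · obtain ⟨N, hN⟩ := (sum_alpha_alpha_vec (K := K) T).exists
        have h3 : (T.energy : K) • B (vec K T) (vec K S) = 0 := by
          rw [← LinearMap.smul_apply, ← map_smul, ← hN, map_sum, LinearMap.sum_apply]
          refine Finset.sum_eq_zero fun n hn => ?_
          have hn0 := (Finset.mem_Ioc.1 hn).1
          rw [eq_add_of_sub_eq (hB n _ _), h2 n hn0, add_zero, hvv, mul_zero]
          intro T' S' hT' hS'
          have := hlow hn0 hT'
          rw [hself hS']
          exact ⟨by omega, hq⟩
        exact (smul_eq_zero.1 h3).resolve_left (by exact_mod_cast hT)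
    -- in `B(v_T, α_{-n} α_n v_S)` the factor `α_{-n}` is moved to the first argument
    · obtain ⟨N, hN⟩ := (sum_alpha_alpha_vec (K := K) S).exists
      have h3 : (S.energy : K) • B (vec K T) (vec K S) = 0 := by
        rw [← map_smul, ← hN, map_sum]
        refine Finset.sum_eq_zero fun n hn => ?_
        have hn0 := (Finset.mem_Ioc.1 hn).1
        have h4 := hB (-n) (vec K T) (alpha K n (vec K S))
        have h5 : B (vec K T) (alpha K n (vec K S)) = 0 := by
          refine hvv _ _ fun T' S' hT' hS' => ?_
          have := hlow hn0 hS'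
          rw [hself hT']
          exact ⟨by omega, (charge_of_alpha_ne_zero hS').trans hq⟩
        rw [neg_neg, h2 n hn0, h5, mul_zero, zero_sub, neg_eq_zero] at h4
        exact h4
      exact (smul_eq_zero.1 h3).resolve_left (by exact_mod_cast hS)
  exact fun T S => main _ T S rfl

end Uniqueness

/-! ### The fermionic bilinear `ψ(y) ψ^*(w)` -/

section FermionForm

open Filter

theorem hasFiniteSupport_of_subset {α M : Type*} [Zero M] {f : α → M} {s : Set α}
    (hs : s.Finite) (h : ∀ x, f x ≠ 0 → x ∈ s) : Function.HasFiniteSupport f :=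
  hs.subset fun x hx => h x hx

/-- Telescoping over an interval of integers, with the sign that makes it valid whatever the
order of the end points. -/
theorem finsum_step {F : Type*} [Field F] (T : ℤ → F) (c d : ℤ) :
    ∑ᶠ j : ℤ, (T (j + 1) - T j) * ((if j < c then 1 else 0) - if j < d then 1 else 0) =
      T c - T d := by
  have tele : ∀ a b : ℤ, a ≤ b → ∑ j ∈ Finset.Ico a b, (T (j + 1) - T j) = T b - T a := by
    intro a b hab
    induction b, hab using Int.leInduction with
    | base => simp
    | succ b hab ih =>
      rw [← Finset.insert_Ico_right_eq_Ico_add_one hab, Finset.sum_insert (by simp), ih]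
      ring
  have key : ∀ a b : ℤ, a ≤ b →
      ∑ᶠ j : ℤ, (T (j + 1) - T j) * ((if j < b then 1 else 0) - if j < a then 1 else 0) =
        T b - T a := by
    intro a b hab
    rw [← tele a b hab, finsum_eq_sum_of_support_subset (s := Finset.Ico a b)]
    · refine Finset.sum_congr rfl fun j hj => ?_
      rw [Finset.mem_Ico] at hj
      rw [if_pos hj.2, if_neg (not_lt.2 hj.1), sub_zero, mul_one]
    · intro j hj
      rw [Function.mem_support] at hj
      rw [Finset.coe_Ico, Set.mem_Ico]
      by_contra h
      apply hj
      by_cases h1 : j < a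
      · rw [if_pos h1, if_pos (h1.trans_le hab), sub_self, mul_zero]
      · rw [if_neg h1, if_neg (fun h2 => h ⟨not_lt.1 h1, h2⟩), sub_self, mul_zero]
  rcases le_total d c with h | h
  · exact key d c h
  · rw [← neg_sub, ← key c d h, ← finsum_neg_distrib]
    refine finsum_congr fun j => ?_
    ring

theorem finsum_shifted_diagonal {F : Type*} [AddCommMonoid F] (f : ℤ × ℤ → F) (n : ℤ)
    (h : ∀ p : ℤ × ℤ, p.1 ≠ p.2 + n → f p = 0) :
    ∑ᶠ p, f p = ∑ᶠ j : ℤ, f (j + n, j) := by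
  have hg : Function.Injective fun j : ℤ => (j + n, j) := fun i j hij => (Prod.ext_iff.1 hij).2
  rw [← finsum_mem_range hg, ← finsum_mem_univ, ← finsum_mem_inter_support,
    ← finsum_mem_inter_support (s := Set.range _)]
  have h1 : Set.univ ∩ Function.support f =
      Set.range (fun j : ℤ => (j + n, j)) ∩ Function.support f := by
    ext p
    refine ⟨fun hp => ⟨⟨p.2, ?_⟩, hp.2⟩, fun hp => ⟨trivial, hp.2⟩⟩
    by_contra hne
    exact hp.2 (h p fun h1 => hne (Prod.ext h1.symm rfl))
  rw [h1]

variable {K : Type*} [Field K]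

theorem finite_pairing_normalPair (u v : Fock K) :
    {p : ℤ × ℤ | pairing u (normalPair K p.1 p.2 v) ≠ 0}.Finite := by
  induction u using vec_induction with
  | h0 => simp
  | hadd u₁ u₂ h₁ h₂ =>
    refine (h₁.union h₂).subset fun p hp => ?_
    by_contra h
    rw [Set.mem_union, not_or, Set.notMem_ofPred_iff, Set.notMem_ofPred_iff, not_not, not_not] at h
    apply hp
    rw [map_add, LinearMap.add_apply, h.1, h.2, add_zero]
  | hsmul c S h =>
    refine h.subset fun p hp h0 => hp ?_
    rw [map_smul, LinearMap.smul_apply, h0, smul_zero]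
  | hvec T =>
    induction v using vec_induction with
    | h0 => simp
    | hadd u₁ u₂ h₁ h₂ =>
      refine (h₁.union h₂).subset fun p hp => ?_
      by_contra h
      rw [Set.mem_union, not_or, Set.notMem_ofPred_iff, Set.notMem_ofPred_iff, not_not,
        not_not] at h
      apply hp
      rw [map_add, map_add, h.1, h.2, add_zero]
    | hsmul c S h =>
      refine h.subset fun p hp h0 => hp ?_
      rw [map_smul, map_smul, h0, smul_zero]
    | hvec S =>
      refine (finite_normalPair (K := K) T S).subset fun p hp => ?_
      rwa [Set.mem_ofPred_eq, pairing_vec] at hp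

variable {F : Type*} [Field F] [Algebra K F]

theorem hasFiniteSupport_fermion (g : ℤ × ℤ → F) (u v : Fock K) :
    Function.HasFiniteSupport fun p : ℤ × ℤ =>
      g p * algebraMap K F (pairing u (normalPair K p.1 p.2 v)) :=
  hasFiniteSupport_of_subset (finite_pairing_normalPair u v) fun p hp h0 => hp (by
    rw [h0, map_zero, mul_zero])

/-- The matrix coefficients of `ψ(y) ψ^*(w) = ∑ y^i w^{-1-j} ψ_i ψ_j^*`, where the vacuum
expectation `∑_{j < 0} y^j w^{-1-j}` is summed to `1 / (y - w)`. -/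
def fermionForm (K : Type*) [Field K] {F : Type*} [Field F] [Algebra K F] (y w : F) :
    Fock K →ₗ[K] Fock K →ₗ[K] F :=
  LinearMap.mk₂ K
    (fun u v => ∑ᶠ p : ℤ × ℤ, y ^ p.1 * w ^ (-1 - p.2) *
        algebraMap K F (pairing u (normalPair K p.1 p.2 v)) +
      (y - w)⁻¹ * algebraMap K F (pairing u v))
    (fun u₁ u₂ v => by
      simp only [map_add, LinearMap.add_apply, mul_add]
      rw [finsum_add_distrib (hasFiniteSupport_fermion _ _ _) (hasFiniteSupport_fermion _ _ _)]
      ring)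
    (fun c u v => by
      simp only [map_smul, LinearMap.smul_apply, smul_eq_mul, map_mul, Algebra.smul_def]
      rw [mul_add, mul_finsum]
      congr 1
      · exact finsum_congr fun p => by ring
      · ring)
    (fun u v₁ v₂ => by
      simp only [map_add, mul_add]
      rw [finsum_add_distrib (hasFiniteSupport_fermion _ _ _) (hasFiniteSupport_fermion _ _ _)]
      ring)
    (fun c u v => by
      simp only [map_smul, smul_eq_mul, map_mul, Algebra.smul_def]
      rw [mul_add, mul_finsum]
      congr 1
      · exact finsum_congr fun p => by ring
      · ring)

theorem fermionForm_apply (y w : F) (u v : Fock K) :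
    fermionForm K y w u v = ∑ᶠ p : ℤ × ℤ, y ^ p.1 * w ^ (-1 - p.2) *
        algebraMap K F (pairing u (normalPair K p.1 p.2 v)) +
      (y - w)⁻¹ * algebraMap K F (pairing u v) := rfl

/-- The Schwinger terms of the commutators with `α_n` add up to `(y^n - w^n) / (y - w)`. -/
theorem finsum_schwinger {y w : F} (hy : y ≠ 0) (hw : w ≠ 0) (hyw : y ≠ w) (n : ℤ) :
    ∑ᶠ p : ℤ × ℤ, y ^ p.1 * w ^ (-1 - p.2) * algebraMap K F
      (if p.1 = p.2 + n then (if p.2 < 0 then 1 else 0) - (if p.2 + n < 0 then 1 else 0)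
        else 0) = (y ^ n - w ^ n) * (y - w)⁻¹ := by
  rw [finsum_shifted_diagonal _ n fun p hp => by rw [if_neg hp, map_zero, mul_zero]]
  have hd : y - w ≠ 0 := sub_ne_zero.2 hyw
  have h1 := finsum_step (fun j : ℤ => y ^ (j + n) * w ^ (-j) * (y - w)⁻¹) 0 (-n)
  rw [zero_add, neg_zero, zpow_zero, mul_one, neg_add_cancel, zpow_zero, one_mul, neg_neg,
    ← sub_mul] at h1
  rw [← h1]
  refine finsum_congr fun j => ?_
  have h2 : (y ^ (j + 1 + n) * w ^ (-(j + 1)) * (y - w)⁻¹ - y ^ (j + n) * w ^ (-j) * (y - w)⁻¹) =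
      y ^ (j + n) * w ^ (-1 - j) := by
    have e1 : y ^ (j + 1 + n) = y ^ (j + n) * y := by
      rw [← zpow_add_one₀ hy]
      congr 1
      ring
    have e2 : w ^ (-j) = w ^ (-1 - j) * w := by
      rw [← zpow_add_one₀ hw]
      congr 1
      ring
    have e3 : w ^ (-(j + 1)) = w ^ (-1 - j) := by
      congr 1
      ring
    rw [e1, e2, e3]
    field_simp
  rw [h2, if_pos rfl]
  congr 1
  rw [map_sub]
  congr 1
  · split_ifs <;> simp
  · by_cases h : j + n < 0
    · rw [if_pos h, if_pos (by omega), map_one]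
    · rw [if_neg h, if_neg (by omega), map_zero]

/-- Commuting `α_n` past `ψ_i ψ_j^*` shifts one of the two indices by `n`, which multiplies the sum by
`y^n` or `w^n`. The Schwinger terms do the same for the vacuum expectation. -/
theorem fermionForm_alpha {y w : F} (hy : y ≠ 0) (hw : w ≠ 0) (hyw : y ≠ w) (n : ℤ)
    (u v : Fock K) :
    fermionForm K y w (alpha K (-n) u) v - fermionForm K y w u (alpha K n v) =
      (y ^ n - w ^ n) * fermionForm K y w u v := by
  have h1 : ∀ p : ℤ × ℤ, pairing (alpha K (-n) u) (normalPair K p.1 p.2 v) =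
      pairing u (normalPair K p.1 p.2 (alpha K n v)) +
      (pairing u (normalPair K (p.1 - n) p.2 v) - pairing u (normalPair K p.1 (p.2 + n) v)) +
      (if p.1 = p.2 + n then (if p.2 < 0 then 1 else 0) - (if p.2 + n < 0 then 1 else 0)
        else 0) * pairing u v := by
    intro p
    rw [pairing_alpha, neg_neg, alpha_normalPair, map_add, map_add, map_sub]
    congr 1
    split_ifs <;> simp
  have h2 : pairing (alpha K (-n) u) v = pairing u (alpha K n v) := by
    rw [pairing_alpha, neg_neg]
  set G : ℤ × ℤ → F := fun p => y ^ p.1 * w ^ (-1 - p.2) with hG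
  let e₁ : ℤ × ℤ ≃ ℤ × ℤ := (Equiv.addRight (-n)).prodCongr (Equiv.refl ℤ)
  let e₂ : ℤ × ℤ ≃ ℤ × ℤ := (Equiv.refl ℤ).prodCongr (Equiv.addRight n)
  have s1 : ∑ᶠ p : ℤ × ℤ, G p * algebraMap K F (pairing u (normalPair K (p.1 - n) p.2 v)) =
      y ^ n * ∑ᶠ p : ℤ × ℤ, G p * algebraMap K F (pairing u (normalPair K p.1 p.2 v)) := by
    rw [mul_finsum]
    refine Eq.trans ?_ (finsum_comp_equiv e₁)
    refine finsum_congr fun p => ?_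
    have e : y ^ p.1 = y ^ n * y ^ (p.1 - n) := by
      rw [← zpow_add₀ hy]
      congr 1
      ring
    simp only [hG, e₁, Equiv.prodCongr_apply, Prod.map, Equiv.coe_addRight, Equiv.refl_apply,
      ← sub_eq_add_neg, e]
    ring
  have s2 : ∑ᶠ p : ℤ × ℤ, G p * algebraMap K F (pairing u (normalPair K p.1 (p.2 + n) v)) =
      w ^ n * ∑ᶠ p : ℤ × ℤ, G p * algebraMap K F (pairing u (normalPair K p.1 p.2 v)) := by
    rw [mul_finsum]
    refine Eq.trans ?_ (finsum_comp_equiv e₂)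
    refine finsum_congr fun p => ?_
    have e : w ^ (-1 - p.2) = w ^ n * w ^ (-1 - (p.2 + n)) := by
      rw [← zpow_add₀ hw]
      congr 1
      ring
    simp only [hG, e₂, Equiv.prodCongr_apply, Prod.map, Equiv.coe_addRight, Equiv.refl_apply, e]
    ring
  have f1 : Function.HasFiniteSupport fun p : ℤ × ℤ =>
      G p * algebraMap K F (pairing u (normalPair K (p.1 - n) p.2 v)) := by
    refine hasFiniteSupport_of_subset ((finite_pairing_normalPair u v).preimage
      e₁.injective.injOn) fun p hp h0 => hp ?_
    simp only [e₁, Equiv.prodCongr_apply, Prod.map, Equiv.coe_addRight, Equiv.refl_apply,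
      ← sub_eq_add_neg] at h0
    rw [h0, map_zero, mul_zero]
  have f2 : Function.HasFiniteSupport fun p : ℤ × ℤ =>
      G p * algebraMap K F (pairing u (normalPair K p.1 (p.2 + n) v)) := by
    refine hasFiniteSupport_of_subset ((finite_pairing_normalPair u v).preimage
      e₂.injective.injOn) fun p hp h0 => hp ?_
    simp only [e₂, Equiv.prodCongr_apply, Prod.map, Equiv.coe_addRight, Equiv.refl_apply] at h0
    rw [h0, map_zero, mul_zero]
  have f0 := hasFiniteSupport_fermion G u (alpha K n v)
  have f12 : Function.HasFiniteSupport fun p : ℤ × ℤ =>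
      G p * algebraMap K F (pairing u (normalPair K (p.1 - n) p.2 v)) -
      G p * algebraMap K F (pairing u (normalPair K p.1 (p.2 + n) v)) :=
    hasFiniteSupport_of_subset (f1.union f2) fun p hp => by
      by_contra h
      rw [Set.mem_union, not_or, Function.notMem_support, Function.notMem_support] at h
      exact hp (by rw [h.1, h.2, sub_zero])
  have s3 : ∑ᶠ p : ℤ × ℤ, G p * algebraMap K F (pairing (alpha K (-n) u)
      (normalPair K p.1 p.2 v)) =
      ∑ᶠ p : ℤ × ℤ, G p * algebraMap K F (pairing u (normalPair K p.1 p.2 (alpha K n v))) +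
      (∑ᶠ p : ℤ × ℤ, G p * algebraMap K F (pairing u (normalPair K (p.1 - n) p.2 v)) -
        ∑ᶠ p : ℤ × ℤ, G p * algebraMap K F (pairing u (normalPair K p.1 (p.2 + n) v))) +
      (y ^ n - w ^ n) * (y - w)⁻¹ * algebraMap K F (pairing u v) := by
    rw [← finsum_schwinger (K := K) hy hw hyw n, finsum_mul, ← finsum_sub_distrib f1 f2,
      ← finsum_add_distrib f0 f12, ← finsum_add_distrib]
    · refine finsum_congr fun p => ?_
      rw [h1]
      simp only [map_add, map_sub, map_mul, hG]
      ring
    · refine hasFiniteSupport_of_subset (f0.union f12) fun p hp => ?_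
      by_contra h
      rw [Set.mem_union, not_or, Function.notMem_support, Function.notMem_support] at h
      exact hp (by rw [h.1, h.2, add_zero])
    · refine hasFiniteSupport_of_subset ((Set.finite_Ico (-|n|) |n|).image
        fun j => (j + n, j)) fun p hp => ?_
      by_contra h
      apply hp
      by_cases h3 : p.1 = p.2 + n
      · have h4 : p.2 ∉ Set.Ico (-|n|) |n| := fun h4 =>
          h ⟨p.2, h4, Prod.ext h3.symm rfl⟩
        rw [Set.mem_Ico, not_and_or, not_le, not_lt] at h4
        have := le_abs_self n
        have := neg_abs_le n
        rw [if_pos h3]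
        have h5 : p.2 < 0 ↔ p.2 + n < 0 := by omega
        simp only [h5, sub_self, map_zero, mul_zero, zero_mul]
      · rw [if_neg h3, map_zero, mul_zero, zero_mul]
  rw [fermionForm_apply, fermionForm_apply, fermionForm_apply, h2]
  simp only [hG] at s1 s2 s3
  rw [s3, s1, s2]
  ring

/-- On the ground state of charge `c` the fermionic sum is the finite geometric sum by which the
vacuum expectation changes when the sites are filled up to `c` instead of `0`. -/
theorem fermionForm_ground {y w : F} (hy : y ≠ 0) (hw : w ≠ 0) (hyw : y ≠ w) {S : Maya} {c : ℤ}
    (hS : ∀ k, k ∈ S.1 ↔ k < c) :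
    fermionForm K y w (vec K S) (vec K S) = (y / w) ^ c * (y - w)⁻¹ := by
  classical
  have hvec : (vec K S) S = 1 := Finsupp.single_eq_same
  have hd : y - w ≠ 0 := sub_ne_zero.2 hyw
  rw [fermionForm_apply, pairing_vec, hvec, map_one, mul_one,
    finsum_shifted_diagonal _ 0 fun p hp => ?_]
  · have h1 := finsum_step (fun j : ℤ => y ^ j * w ^ (-j) * (y - w)⁻¹) c 0
    rw [neg_zero, zpow_zero, zpow_zero, one_mul, one_mul, eq_sub_iff_add_eq] at h1
    rw [div_zpow, div_eq_mul_inv, ← zpow_neg, ← h1]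
    congr 1
    refine finsum_congr fun j => ?_
    have h2 : (y ^ (j + 1) * w ^ (-(j + 1)) * (y - w)⁻¹ - y ^ j * w ^ (-j) * (y - w)⁻¹) =
        y ^ j * w ^ (-1 - j) := by
      have e2 : w ^ (-j) = w ^ (-1 - j) * w := by
        rw [← zpow_add_one₀ hw]
        congr 1
        ring
      have e3 : w ^ (-(j + 1)) = w ^ (-1 - j) := by
        congr 1
        ring
      rw [zpow_add_one₀ hy, e2, e3]
      field_simp
    simp only [add_zero]
    rw [h2, pairing_vec, normalPair_self_vec, Finsupp.smul_apply, hvec, smul_eq_mul, mul_one,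
      map_sub]
    simp only [hS]
    congr 2 <;> split_ifs <;> simp
  · rw [pairing_vec]
    have h : normalPair K p.1 p.2 (vec K S) S = 0 := by
      by_contra h
      obtain ⟨h1, h2⟩ := mem_of_normalPair_ne_zero (by simpa using hp) h
      exact h1.2 h1.1
    rw [h, map_zero, mul_zero]

end FermionForm

/-! ### The normally ordered exponential -/

section BosonForm

open Filter

variable {K : Type*} [Field K]

/-- The Leibniz rule for the commutator of `α_n` with a product in increasing order: only the factors
`α_{-n}` contribute, and these stand next to each other. -/
theorem alpha_listProd {L : List ℤ} (hL : L.Pairwise (· ≤ ·)) (n : ℤ) (v : Fock K) :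
    alpha K n ((L.map (alpha K)).prod v) = (L.map (alpha K)).prod (alpha K n v) +
      (L.count (-n) * n : K) • ((L.erase (-n)).map (alpha K)).prod v := by
  induction L with
  | nil => simp
  | cons a L ih =>
    obtain ⟨ha, hL'⟩ := List.pairwise_cons.1 hL
    rw [List.map_cons, List.prod_cons, Module.End.mul_apply, Module.End.mul_apply, alpha_alpha,
      ih hL', map_add, map_smul, add_assoc]
    congr 1
    by_cases h : a = -n
    · subst h
      rw [List.count_cons_self, List.erase_cons_head, if_pos (by omega)]
      -- `a` is the least element of the list, hence a repetition of it stands next to it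
      have h1 : (-n) ∈ L → L = -n :: L.erase (-n) := by
        intro hmem
        rcases L with _ | ⟨b, L⟩
        · simp at hmem
        · have hb : b = -n := by
            rcases List.mem_cons.1 hmem with h2 | h2
            · exact h2.symm
            · exact le_antisymm ((List.pairwise_cons.1 hL').1 _ h2) (ha b List.mem_cons_self)
          rw [hb, List.erase_cons_head]
      by_cases hmem : (-n) ∈ L
      · have h2 : alpha K (-n) (((L.erase (-n)).map (alpha K)).prod v) =
            (L.map (alpha K)).prod v := by
          conv_rhs => rw [h1 hmem]
          rfl
        rw [h2]
        push_cast
        module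
      · rw [List.count_eq_zero_of_not_mem hmem]
        push_cast
        module
    · rw [if_neg (by omega), add_zero, List.count_cons_of_ne h,
        List.erase_cons_tail (by simpa using h), List.map_cons, List.prod_cons,
        Module.End.mul_apply]

theorem normalMonomial_perm {l l' : List {n : ℤ // n ≠ 0}} (h : l.Perm l') :
    normalMonomial K l = normalMonomial K l' := by
  rw [normalMonomial, normalMonomial]
  congr 2
  exact List.Perm.eq_of_pairwise' (List.pairwise_insertionSort _ _)
    (List.pairwise_insertionSort _ _) ((List.perm_insertionSort _ _).trans
      ((h.map _).trans (List.perm_insertionSort _ _).symm))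

theorem alpha_normalMonomial (x : {n : ℤ // n ≠ 0}) (l : List {n : ℤ // n ≠ 0}) (v : Fock K) :
    alpha K (-x.1) (normalMonomial K l v) = normalMonomial K l (alpha K (-x.1) v) -
      (l.count x * x.1 : K) • normalMonomial K (l.erase x) v := by
  have h2 : ((l.map Subtype.val).insertionSort (· ≤ ·)).count x.1 = l.count x := by
    rw [(List.perm_insertionSort _ _).count_eq]
    exact List.count_map_of_injective l _ Subtype.val_injective x
  have h3 : ((l.map Subtype.val).insertionSort (· ≤ ·)).erase x.1 =
      ((l.erase x).map Subtype.val).insertionSort (· ≤ ·) := by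
    refine List.Perm.eq_of_pairwise' ((List.pairwise_insertionSort _ _).sublist
      List.erase_sublist) (List.pairwise_insertionSort _ _) ?_
    rw [List.map_erase Subtype.val_injective]
    exact ((List.perm_insertionSort _ _).erase _).trans (List.perm_insertionSort _ _).symm
  have h1 := alpha_listProd (K := K) (List.pairwise_insertionSort (· ≤ ·) (l.map Subtype.val))
    (-x.1) v
  rw [neg_neg, h2, h3] at h1
  rw [normalMonomial, h1, normalMonomial]
  push_cast
  module

theorem alpha_zero_normalMonomial (l : List {n : ℤ // n ≠ 0}) (v : Fock K) :
    alpha K 0 (normalMonomial K l v) = normalMonomial K l (alpha K 0 v) := by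
  have h1 := alpha_listProd (K := K) (List.pairwise_insertionSort (· ≤ ·) (l.map Subtype.val))
    0 v
  rw [normalMonomial, h1]
  simp

/-! #### Words in a finite alphabet -/

/-- The words of length `p` in the alphabet `A`. -/
def words {X : Type*} (A : Finset X) : ℕ → Finset (List X)
  | 0 => {[]}
  | p + 1 => (A ×ˢ words A p).map
      ⟨fun y => y.1 :: y.2, fun _ _ h => Prod.ext (List.cons.inj h).1 (List.cons.inj h).2⟩

theorem mem_words {X : Type*} {A : Finset X} {p : ℕ} {l : List X} :
    l ∈ words A p ↔ l.length = p ∧ ∀ x ∈ l, x ∈ A := by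
  induction p generalizing l with
  | zero =>
    rw [words, Finset.mem_singleton, List.length_eq_zero_iff]
    exact ⟨fun h => ⟨h, by simp [h]⟩, fun h => h.1⟩
  | succ p ih =>
    rw [words, Finset.mem_map]
    constructor
    · rintro ⟨⟨b, l'⟩, h, rfl⟩
      obtain ⟨hb, hl⟩ := Finset.mem_product.1 h
      obtain ⟨h1, h2⟩ := ih.1 hl
      refine ⟨congrArg (· + 1) h1, fun x hx => ?_⟩
      rcases List.mem_cons.1 hx with rfl | hx
      exacts [hb, h2 x hx]
    · rintro ⟨h1, h2⟩
      rcases l with _ | ⟨b, l'⟩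
      · simp at h1
      · refine ⟨(b, l'), Finset.mem_product.2 ⟨h2 b List.mem_cons_self, ih.2 ⟨?_, ?_⟩⟩, rfl⟩
        · simpa using h1
        · exact fun x hx => h2 x (List.mem_cons_of_mem _ hx)

theorem sum_words_succ {X F : Type*} [CommSemiring F] (A : Finset X) (a : X → F) (p : ℕ)
    (H : List X → F) :
    ∑ l ∈ words A (p + 1), (l.map a).prod * H l =
      ∑ b ∈ A, a b * ∑ l ∈ words A p, (l.map a).prod * H (b :: l) := by
  rw [words, Finset.sum_map, Finset.sum_product]
  refine Finset.sum_congr rfl fun b _ => ?_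
  rw [Finset.mul_sum]
  refine Finset.sum_congr rfl fun l _ => ?_
  change ((b :: l).map a).prod * H (b :: l) = _
  rw [List.map_cons, List.prod_cons]
  ring

/-- Removing a letter from the words of length `p + 1` produces each word of length `p` in `p + 1`
ways. -/
theorem sum_words_count_erase {X F : Type*} [BEq X] [LawfulBEq X] [CommSemiring F] (A : Finset X)
    (a : X → F) {x : X} (hx : x ∈ A) (p : ℕ) (G : List X → F)
    (hG : ∀ l l' : List X, l.Perm l' → G l = G l') :
    ∑ l ∈ words A (p + 1), (l.map a).prod * (l.count x * G (l.erase x)) =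
      (p + 1) * a x * ∑ l ∈ words A p, (l.map a).prod * G l := by
  classical
  induction p generalizing G with
  | zero =>
    rw [sum_words_succ]
    simp only [words, Finset.sum_singleton, List.map_nil, List.prod_nil, one_mul]
    rw [Finset.sum_eq_single_of_mem x hx]
    · simp
    · intro b _ hb
      simp [List.count_cons_of_ne hb]
  | succ p ih =>
    rw [sum_words_succ]
    have h1 : ∀ b (l : List X), ((b :: l).count x : F) * G ((b :: l).erase x) =
        (if b = x then G l else 0) + l.count x * G (b :: l.erase x) := by
      intro b l
      by_cases hb : b = x
      · subst hb
        rw [List.count_cons_self, List.erase_cons_head, if_pos rfl]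
        by_cases hmem : b ∈ l
        · rw [← hG _ _ (List.perm_cons_erase hmem)]
          push_cast
          ring
        · rw [List.count_eq_zero_of_not_mem hmem]
          simp
      · rw [if_neg hb, List.count_cons_of_ne hb, List.erase_cons_tail (by simpa using hb), zero_add]
    simp only [h1, mul_add, Finset.sum_add_distrib]
    have h2 : ∑ b ∈ A, a b * ∑ l ∈ words A (p + 1), (l.map a).prod * (if b = x then G l else 0) =
        a x * ∑ l ∈ words A (p + 1), (l.map a).prod * G l := by
      rw [Finset.sum_eq_single_of_mem x hx]
      · simp
      · intro b _ hb
        simp [hb]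
    have h3 : ∑ b ∈ A, a b * ∑ l ∈ words A (p + 1),
        (l.map a).prod * (l.count x * G (b :: l.erase x)) =
        (p + 1) * a x * ∑ l ∈ words A (p + 1), (l.map a).prod * G l := by
      rw [sum_words_succ, Finset.mul_sum]
      refine Finset.sum_congr rfl fun b _ => ?_
      rw [ih (fun l => G (b :: l)) fun l l' h => hG _ _ (h.cons b)]
      ring
    rw [h2, h3]
    push_cast
    ring

/-! #### Matrix coefficients of normally ordered monomials and of the exponential -/

variable [CharZero K]

theorem energy_of_listProd_ne_zero {L : List ℤ} {S T : Maya}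
    (h : (L.map (alpha K)).prod (vec K S) T ≠ 0) : (T.energy : ℤ) = S.energy - L.sum := by
  classical
  induction L generalizing T with
  | nil =>
    rw [List.map_nil, List.prod_nil, Module.End.one_apply, vec, Finsupp.single_apply] at h
    have : S = T := by
      by_contra hne
      exact h (if_neg hne)
    simp [this]
  | cons a L ih =>
    rw [List.map_cons, List.prod_cons, Module.End.mul_apply] at h
    by_contra hne
    refine h (eq_zero_of_vec (Finsupp.lapply T ∘ₗ alpha K a) fun S' hS' => ?_)
    by_contra h1
    have h2 := energy_of_alpha_ne_zero (K := K) (n := a) (S := S') (T := T) h1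
    have h3 := ih hS'
    rw [List.sum_cons] at hne
    omega

theorem listProd_vec_eq_zero {L : List ℤ} (hL : L.Pairwise (· ≤ ·)) {S : Maya}
    (h : (S.energy : ℤ) < (L.map fun n => max n 0).sum) :
    (L.map (alpha K)).prod (vec K S) = 0 := by
  induction L with
  | nil =>
    simp at h
    omega
  | cons a L ih =>
    obtain ⟨ha, hL'⟩ := List.pairwise_cons.1 hL
    by_cases ha0 : 0 ≤ a
    · ext T
      by_contra hT
      have h1 := energy_of_listProd_ne_zero hT
      have h2 : ((a :: L).map fun n => max n 0) = (a :: L).map id := by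
        refine List.map_congr_left fun n hn => max_eq_left ?_
        rcases List.mem_cons.1 hn with rfl | hn
        exacts [ha0, ha0.trans (ha n hn)]
      rw [h2, List.map_id] at h
      omega
    · rw [List.map_cons, List.sum_cons, max_eq_right (not_le.1 ha0).le, zero_add] at h
      rw [List.map_cons, List.prod_cons, Module.End.mul_apply, ih hL' h, map_zero]

/-- The positive indices of a nonvanishing normally ordered monomial lower the energy of `v_S`
before the negative ones raise it to that of `v_T`. -/
theorem sum_abs_le_of_normalMonomial_ne_zero {l : List {n : ℤ // n ≠ 0}} {S T : Maya}
    (h : normalMonomial K l (vec K S) T ≠ 0) :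
    (l.map fun n => |n.1|).sum ≤ S.energy + T.energy := by
  set L := (l.map Subtype.val).insertionSort (· ≤ ·) with hL
  have h1 : (L.map fun n => max n 0).sum ≤ S.energy := by
    by_contra hlt
    apply h
    rw [normalMonomial, listProd_vec_eq_zero (List.pairwise_insertionSort _ _) (not_le.1 hlt)]
    rfl
  have h2 := energy_of_listProd_ne_zero (L := L) h
  have h3 : (l.map fun n => |n.1|).sum = (L.map fun n => |n|).sum := by
    rw [((List.perm_insertionSort (· ≤ ·) (l.map Subtype.val)).map fun n : ℤ => |n|).sum_eq,
      List.map_map]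
    rfl
  have h4 : ∀ M : List ℤ, (M.map fun n => |n|).sum = 2 * (M.map fun n => max n 0).sum - M.sum := by
    intro M
    induction M with
    | nil => simp
    | cons a M ih =>
      rw [List.map_cons, List.map_cons, List.sum_cons, List.sum_cons, List.sum_cons, ih]
      have : |a| = 2 * max a 0 - a := by
        rcases le_total 0 a with h | h
        · rw [abs_of_nonneg h, max_eq_left h]
          ring
        · rw [abs_of_nonpos h, max_eq_right h]
          ring
      rw [this]
      ring
  rw [h3, h4]
  omega

/-- The indices of the normally ordered monomials with nonzero coefficient between two given vectors
have bounded absolute sum, so only finitely many words contribute. -/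
theorem exists_bound_pairing_normalMonomial (u v : Fock K) : ∃ M : ℤ, ∀ l,
    pairing u (normalMonomial K l v) ≠ 0 → (l.map fun n => |n.1|).sum ≤ M := by
  induction u using vec_induction with
  | h0 => simp
  | hadd u₁ u₂ h₁ h₂ =>
    obtain ⟨M₁, h₁⟩ := h₁
    obtain ⟨M₂, h₂⟩ := h₂
    refine ⟨max M₁ M₂, fun l hl => ?_⟩
    by_cases h : pairing u₁ (normalMonomial K l v) = 0
    · refine le_max_of_le_right (h₂ l fun h' => hl ?_)
      rw [map_add, LinearMap.add_apply, h, h', add_zero]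
    · exact le_max_of_le_left (h₁ l h)
  | hsmul c S h =>
    obtain ⟨M, h⟩ := h
    refine ⟨M, fun l hl => h l fun h' => hl ?_⟩
    rw [map_smul, LinearMap.smul_apply, h', smul_zero]
  | hvec T =>
    induction v using vec_induction with
    | h0 => simp
    | hadd u₁ u₂ h₁ h₂ =>
      obtain ⟨M₁, h₁⟩ := h₁
      obtain ⟨M₂, h₂⟩ := h₂
      refine ⟨max M₁ M₂, fun l hl => ?_⟩
      by_cases h : pairing (vec K T) (normalMonomial K l u₁) = 0
      · refine le_max_of_le_right (h₂ l fun h' => hl ?_)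
        rw [map_add, map_add, h, h', add_zero]
      · exact le_max_of_le_left (h₁ l h)
    | hsmul c S h =>
      obtain ⟨M, h⟩ := h
      refine ⟨M, fun l hl => h l fun h' => hl ?_⟩
      rw [map_smul, map_smul, h', smul_zero]
    | hvec S =>
      refine ⟨S.energy + T.energy, fun l hl => ?_⟩
      rw [pairing_vec] at hl
      exact sum_abs_le_of_normalMonomial_ne_zero hl

theorem exists_words_of_sum_abs_le (M : ℤ) : ∃ (A : Finset {n : ℤ // n ≠ 0}) (P : ℕ),
    ∀ l : List {n : ℤ // n ≠ 0}, (l.map fun n => |n.1|).sum ≤ M →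
      l.length < P ∧ ∀ x ∈ l, x ∈ A := by
  have hfin : {n : {n : ℤ // n ≠ 0} | n.1 ∈ Set.Icc (-M) M}.Finite :=
    (Set.finite_Icc (-M) M).preimage Subtype.val_injective.injOn
  refine ⟨hfin.toFinset, (M + 1).toNat, fun l hl => ⟨?_, fun x hx => ?_⟩⟩
  · have h1 : ∀ l : List {n : ℤ // n ≠ 0}, (l.length : ℤ) ≤ (l.map fun n => |n.1|).sum := by
      intro l
      induction l with
      | nil => simp
      | cons a l ih =>
        rw [List.length_cons, List.map_cons, List.sum_cons]
        have := Int.one_le_abs a.2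
        push_cast
        omega
    have := h1 l
    omega
  · have h2 : |x.1| ≤ M := by
      refine le_trans (List.single_le_sum (fun n hn => ?_) _
        (List.mem_map_of_mem (f := fun n : {n : ℤ // n ≠ 0} => |n.1|) hx)) hl
      obtain ⟨y, -, rfl⟩ := List.mem_map.1 hn
      exact abs_nonneg y.1
    simpa using abs_le.1 h2

variable {F : Type*} [Field F] [Algebra K F]

/-- The coefficient of a word in the expansion of the normally ordered exponential. -/
def wordWeight (a : {n : ℤ // n ≠ 0} → F) (l : List {n : ℤ // n ≠ 0}) : F :=
  (l.length.factorial : F)⁻¹ * (l.map a).prod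

theorem finite_words (M : ℤ) :
    {l : List {n : ℤ // n ≠ 0} | (l.map fun n => |n.1|).sum ≤ M}.Finite := by
  classical
  obtain ⟨A, P, h⟩ := exists_words_of_sum_abs_le M
  refine ((Finset.range P).biUnion (words A)).finite_toSet.subset fun l hl => ?_
  obtain ⟨h1, h2⟩ := h l hl
  exact Finset.mem_biUnion.2 ⟨l.length, Finset.mem_range.2 h1, mem_words.2 ⟨rfl, h2⟩⟩

theorem hasFiniteSupport_boson (a : {n : ℤ // n ≠ 0} → F) (u v : Fock K) :
    Function.HasFiniteSupport fun l =>
      wordWeight a l * algebraMap K F (pairing u (normalMonomial K l v)) := by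
  obtain ⟨M, hM⟩ := exists_bound_pairing_normalMonomial u v
  refine hasFiniteSupport_of_subset (finite_words M) fun l hl => hM l fun h => hl ?_
  rw [h, map_zero, mul_zero]

/-- The matrix coefficients of `:exp(∑_{n ≠ 0} a_n α_n):`. -/
def bosonForm (K : Type*) [Field K] [CharZero K] {F : Type*} [Field F] [Algebra K F]
    (a : {n : ℤ // n ≠ 0} → F) : Fock K →ₗ[K] Fock K →ₗ[K] F :=
  LinearMap.mk₂ K
    (fun u v => ∑ᶠ l, wordWeight a l * algebraMap K F (pairing u (normalMonomial K l v)))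
    (fun u₁ u₂ v => by
      simp only [map_add, LinearMap.add_apply, mul_add]
      rw [finsum_add_distrib (hasFiniteSupport_boson _ _ _) (hasFiniteSupport_boson _ _ _)])
    (fun c u v => by
      simp only [map_smul, LinearMap.smul_apply, smul_eq_mul, map_mul, Algebra.smul_def]
      rw [mul_finsum]
      exact finsum_congr fun p => by ring)
    (fun u v₁ v₂ => by
      simp only [map_add, mul_add]
      rw [finsum_add_distrib (hasFiniteSupport_boson _ _ _) (hasFiniteSupport_boson _ _ _)])
    (fun c u v => by
      simp only [map_smul, smul_eq_mul, map_mul, Algebra.smul_def]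
      rw [mul_finsum]
      exact finsum_congr fun p => by ring)

theorem bosonForm_apply (a : {n : ℤ // n ≠ 0} → F) (u v : Fock K) :
    bosonForm K a u v =
      ∑ᶠ l, wordWeight a l * algebraMap K F (pairing u (normalMonomial K l v)) := rfl

theorem bosonForm_eq_sum (a : {n : ℤ // n ≠ 0} → F) (u v : Fock K)
    (A : Finset {n : ℤ // n ≠ 0}) (P : ℕ)
    (h : ∀ l, pairing u (normalMonomial K l v) ≠ 0 → l.length < P ∧ ∀ x ∈ l, x ∈ A) :
    bosonForm K a u v = ∑ p ∈ Finset.range P, (p.factorial : F)⁻¹ *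
      ∑ l ∈ words A p, (l.map a).prod * algebraMap K F (pairing u (normalMonomial K l v)) := by
  classical
  rw [bosonForm_apply, finsum_eq_sum_of_support_subset
    (s := (Finset.range P).biUnion (words A)), Finset.sum_biUnion]
  · refine Finset.sum_congr rfl fun p _ => ?_
    rw [Finset.mul_sum]
    refine Finset.sum_congr rfl fun l hl => ?_
    rw [wordWeight, (mem_words.1 hl).1]
    ring
  · intro p _ q _ hpq
    refine Finset.disjoint_left.2 fun l hl hl' => hpq ?_
    rw [← (mem_words.1 hl).1, ← (mem_words.1 hl').1]
  · intro l hl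
    have h1 : pairing u (normalMonomial K l v) ≠ 0 := fun h0 => hl (by
      simp only [h0, map_zero, mul_zero])
    obtain ⟨h2, h3⟩ := h l h1
    exact Finset.mem_biUnion.2 ⟨l.length, Finset.mem_range.2 h2, mem_words.2 ⟨rfl, h3⟩⟩

/-- The commutator of `α_{-m}` with `:exp(∑ a_n α_n):` is `-m a_m` times the exponential. -/
theorem bosonForm_alpha [CharZero F] (a : {n : ℤ // n ≠ 0} → F) (x : {n : ℤ // n ≠ 0})
    (u v : Fock K) :
    bosonForm K a (alpha K x.1 u) v - bosonForm K a u (alpha K (-x.1) v) =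
      -(x.1 : F) * a x * bosonForm K a u v := by
  classical
  obtain ⟨M₁, h₁⟩ := exists_bound_pairing_normalMonomial (alpha K x.1 u) v
  obtain ⟨M₂, h₂⟩ := exists_bound_pairing_normalMonomial u (alpha K (-x.1) v)
  obtain ⟨M₃, h₃⟩ := exists_bound_pairing_normalMonomial u v
  obtain ⟨A₀, P, hA₀⟩ := exists_words_of_sum_abs_le (max M₁ (max M₂ M₃))
  set A := insert x A₀ with hA
  have hw : ∀ l : List {n : ℤ // n ≠ 0}, (l.map fun n => |n.1|).sum ≤ max M₁ (max M₂ M₃) →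
      l.length < P ∧ ∀ x ∈ l, x ∈ A := fun l hl =>
    ⟨(hA₀ l hl).1, fun y hy => Finset.mem_insert_of_mem ((hA₀ l hl).2 y hy)⟩
  have hx : x ∈ A := Finset.mem_insert_self _ _
  have e₁ := bosonForm_eq_sum a (alpha K x.1 u) v A (P + 1) fun l hl =>
    ⟨(hw l ((h₁ l hl).trans (le_max_left _ _))).1.trans P.lt_succ_self,
      (hw l ((h₁ l hl).trans (le_max_left _ _))).2⟩
  have e₂ := bosonForm_eq_sum a u (alpha K (-x.1) v) A (P + 1) fun l hl =>
    ⟨(hw l ((h₂ l hl).trans (le_max_of_le_right (le_max_left _ _)))).1.trans P.lt_succ_self,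
      (hw l ((h₂ l hl).trans (le_max_of_le_right (le_max_left _ _)))).2⟩
  have e₃ := bosonForm_eq_sum a u v A P fun l hl =>
    hw l ((h₃ l hl).trans (le_max_of_le_right (le_max_right _ _)))
  rw [e₁, e₂, e₃, ← Finset.sum_sub_distrib]
  have h4 : ∀ p ∈ Finset.range (P + 1), (p.factorial : F)⁻¹ * ∑ l ∈ words A p, (l.map a).prod *
        algebraMap K F (pairing (alpha K x.1 u) (normalMonomial K l v)) -
      (p.factorial : F)⁻¹ * ∑ l ∈ words A p, (l.map a).prod *
        algebraMap K F (pairing u (normalMonomial K l (alpha K (-x.1) v))) =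
      -(x.1 : F) * ((p.factorial : F)⁻¹ * ∑ l ∈ words A p, (l.map a).prod * (l.count x *
        algebraMap K F (pairing u (normalMonomial K (l.erase x) v)))) := by
    intro p _
    rw [← mul_sub, ← Finset.sum_sub_distrib, mul_left_comm (-(x.1 : F))]
    congr 1
    rw [Finset.mul_sum]
    refine Finset.sum_congr rfl fun l _ => ?_
    rw [pairing_alpha, alpha_normalMonomial, map_sub, map_smul, smul_eq_mul]
    simp only [map_sub, map_mul, map_natCast, map_intCast]
    ring
  have h5 : ∑ l ∈ words A 0, (l.map a).prod * ((l.count x : F) *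
        algebraMap K F (pairing u (normalMonomial K (l.erase x) v))) = 0 := by
    simp [words]
  rw [Finset.sum_congr rfl h4, Finset.sum_range_succ', h5, mul_zero, mul_zero, add_zero,
    Finset.mul_sum]
  refine Finset.sum_congr rfl fun p _ => ?_
  rw [sum_words_count_erase A a hx p (fun l => algebraMap K F (pairing u (normalMonomial K l v)))
    fun l l' h => by rw [normalMonomial_perm h], Nat.factorial_succ]
  have hp : ((p : F) + 1) ≠ 0 := by exact_mod_cast p.succ_ne_zero
  push_cast
  field_simp

theorem bosonForm_alpha_zero (a : {n : ℤ // n ≠ 0} → F) (u v : Fock K) :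
    bosonForm K a (alpha K 0 u) v = bosonForm K a u (alpha K 0 v) := by
  rw [bosonForm_apply, bosonForm_apply]
  refine finsum_congr fun l => ?_
  rw [pairing_alpha, neg_zero, alpha_zero_normalMonomial]

/-- On a ground state every word but the empty one has vanishing expectation. -/
theorem bosonForm_ground (a : {n : ℤ // n ≠ 0} → F) {S : Maya} (hS : S.energy = 0) :
    bosonForm K a (vec K S) (vec K S) = 1 := by
  rw [bosonForm_apply, finsum_eq_single _ []]
  · have h : (vec K S) S = 1 := Finsupp.single_eq_same
    have h' : normalMonomial K [] (vec K S) = vec K S := rfl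
    rw [h', pairing_vec, h, wordWeight]
    simp
  · intro l hl
    have h : pairing (vec K S) (normalMonomial K l (vec K S)) = 0 := by
      rw [pairing_vec]
      by_contra h
      have h1 := sum_abs_le_of_normalMonomial_ne_zero h
      rw [hS] at h1
      rcases l with _ | ⟨b, l⟩
      · exact hl rfl
      · rw [List.map_cons, List.sum_cons] at h1
        have h2 := Int.one_le_abs b.2
        have h3 : 0 ≤ (l.map fun n => |n.1|).sum := List.sum_nonneg fun n hn => by
          obtain ⟨y, -, rfl⟩ := List.mem_map.1 hn
          exact abs_nonneg y.1
        push_cast at h1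
        omega
    rw [h, map_zero, mul_zero]

/-- The boson-fermion correspondence for the bilinear `ψ(y) ψ^*(w)`. -/
theorem fermionForm_eq_bosonForm [CharZero F] {y w : F} (hy : y ≠ 0) (hw : w ≠ 0) (hyw : y ≠ w)
    (T S : Maya) :
    fermionForm K y w (vec K T) (vec K S) = (y / w) ^ S.charge * (y - w)⁻¹ *
      bosonForm K (fun n => (w ^ (-n.1) - y ^ (-n.1)) / (n.1 : F)) (vec K T) (vec K S) := by
  set a : {n : ℤ // n ≠ 0} → F := fun n => (w ^ (-n.1) - y ^ (-n.1)) / (n.1 : F) with ha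
  set κ : F := (y / w) ^ S.charge * (y - w)⁻¹ with hκ
  let B : Fock K →ₗ[K] Fock K →ₗ[K] F :=
    LinearMap.mk₂ K (fun u v => fermionForm K y w u v - κ * bosonForm K a u v)
      (fun u₁ u₂ v => by simp only [map_add, LinearMap.add_apply]; ring)
      (fun c u v => by
        simp only [map_smul, LinearMap.smul_apply, Algebra.smul_def]; ring)
      (fun u v₁ v₂ => by simp only [map_add]; ring)
      (fun c u v => by simp only [map_smul, Algebra.smul_def]; ring)
  have hBapp : ∀ u v, B u v = fermionForm K y w u v - κ * bosonForm K a u v := fun u v => rfl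
  have h := form_eq_zero B (c := fun n => y ^ n - w ^ n) (by simp) (fun n u v => ?_)
    (q := S.charge) (fun S' h0 hq => ?_) T S rfl
  · rw [hBapp] at h
    exact sub_eq_zero.1 h
  · have h1 := fermionForm_alpha (K := K) hy hw hyw n u v
    have h2 : bosonForm K a (alpha K (-n) u) v - bosonForm K a u (alpha K n v) =
        (y ^ n - w ^ n) * bosonForm K a u v := by
      rcases eq_or_ne n 0 with rfl | hn
      · rw [neg_zero, bosonForm_alpha_zero]
        simp
      · have h3 := bosonForm_alpha (K := K) a ⟨-n, neg_ne_zero.2 hn⟩ u v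
        simp only [neg_neg] at h3
        rw [h3]
        congr 1
        have hn' : (n : F) ≠ 0 := by exact_mod_cast hn
        simp only [ha, neg_neg]
        push_cast
        field_simp
        ring
    rw [hBapp, hBapp, hBapp]
    linear_combination h1 - κ * h2
  · obtain ⟨c, hc⟩ := Maya.exists_of_energy_eq_zero h0
    rw [hBapp, bosonForm_ground a h0, fermionForm_ground hy hw hyw hc, hκ, ← hq,
      Maya.charge_of_forall hc, mul_one, sub_self]

end BosonForm

/-! ### Comparison of the two sides -/

section Comparison

variable {K : Type*} [Field K]

/-- The boson-fermion correspondence in terms of matrix coefficients between basis vectors. The field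
`F` receives `K` through an explicit homomorphism, since iterated Laurent series carry several
`K`-algebra structures. -/
theorem bosonization [CharZero K] {F : Type*} [Field F] [CharZero F] (φ : K →+* F) {y w : F}
    (hy : y ≠ 0) (hw : w ≠ 0) (hyw : y ≠ w) (T S : Maya) :
    ∑ᶠ p : ℤ × ℤ, y ^ p.1 * w ^ (-1 - p.2) * φ (normalPair K p.1 p.2 (vec K S) T) +
        (y - w)⁻¹ * φ (vec K S T) =
      (y / w) ^ S.charge * (y - w)⁻¹ * ∑ᶠ l : List {n : ℤ // n ≠ 0},
        (l.length.factorial : F)⁻¹ *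
          (l.map fun n => (w ^ (-n.1) - y ^ (-n.1)) / (n.1 : F)).prod *
          φ (normalMonomial K l (vec K S) T) := by
  let := φ.toAlgebra
  have h := fermionForm_eq_bosonForm (K := K) hy hw hyw T S
  simp only [fermionForm_apply, bosonForm_apply, pairing_vec, wordWeight] at h
  exact h

theorem coeff_coeffZ (k : ℤ) (f : LSerX K) (n : ℤ) :
    (coeffZ k f).coeff n = (f.coeff n).coeff k := rfl

theorem coeffZ_add (k : ℤ) (f g : LSerX K) : coeffZ k (f + g) = coeffZ k f + coeffZ k g := by
  ext n
  simp only [coeff_coeffZ, HahnSeries.coeff_add]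

theorem coeffZ_sum {ι : Type*} (s : Finset ι) (k : ℤ) (f : ι → LSerX K) :
    coeffZ k (∑ i ∈ s, f i) = ∑ i ∈ s, coeffZ k (f i) := by
  ext n
  simp only [coeff_coeffZ, HahnSeries.coeff_sum]

theorem coeffZ_mul_C (k : ℤ) (f : LSerX K) (c : K) :
    coeffZ k (f * HahnSeries.C (HahnSeries.C c)) = coeffZ k f * HahnSeries.C c := by
  ext n
  rw [coeff_coeffZ, mul_comm f, mul_comm (coeffZ k f), HahnSeries.C_mul_eq_smul,
    HahnSeries.C_mul_eq_smul, HahnSeries.coeff_smul, HahnSeries.coeff_smul, coeff_coeffZ,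
    smul_eq_mul, HahnSeries.C_mul_eq_smul, HahnSeries.coeff_smul]

/-- Multiplication by `z^n` shifts the coefficients. -/
theorem coeffZ_single_mul (k n : ℤ) (f : LSerX K) :
    coeffZ (k + n) (HahnSeries.C (HahnSeries.single n 1) * f) = coeffZ k f := by
  ext m
  rw [coeff_coeffZ, HahnSeries.C_mul_eq_smul, HahnSeries.coeff_smul, coeff_coeffZ, smul_eq_mul,
    HahnSeries.coeff_single_mul_add, one_mul]

theorem coeffZ_coe (k : ℤ) (f : SerX K) : coeffZ k (f : LSerX K) =
    ((PowerSeries.mk fun m => (PowerSeries.coeff m f).coeff k : PowerSeries K) :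
      LaurentSeries K) := by
  ext n
  rw [coeff_coeffZ, PowerSeries.coeff_coe, PowerSeries.coeff_coe]
  split_ifs
  · rfl
  · rw [PowerSeries.coeff_mk]

/-- `z^n = y^{-n}`. -/
theorem C_single_eq_zpow (n : ℤ) :
    (HahnSeries.C (HahnSeries.single n 1) : LSerX K) =
      ((PowerSeries.C yVar : SerX K) : LSerX K) ^ (-n) := by
  rw [PowerSeries.coe_C, ← map_zpow₀, ← single_eq_yVar_zpow]

/-- The matrix coefficient of `π(e^{xB})` in terms of the symbols: the entry `(i, j)` of `e^{xB}` is
the coefficient of `z^{i-j}` in the symbol of index `j`, and the contour integral takes the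
coefficient of `z`. -/
theorem coe_mk_piCoeff (B : Module.End K (Ser K)) (T S : Maya) :
    ((PowerSeries.mk fun m =>
      piCoeff K (fun i j => (m.factorial : K)⁻¹ * entry (B ^ m) i j) T S : PowerSeries K) :
      LaurentSeries K) =
    contour (∑ᶠ p : ℤ × ℤ, HahnSeries.C (HahnSeries.single (p.2 - p.1 + 1) 1) *
      (symbol B p.2 : LSerX K) *
        HahnSeries.C (HahnSeries.C (normalPair K p.1 p.2 (vec K S) T))) := by
  set P := (finite_normalPair (K := K) T S).toFinset with hP
  have h0 : ∀ p : ℤ × ℤ, normalPair K p.1 p.2 (vec K S) T ≠ 0 → p ∈ P := fun p hp => by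
    simpa [hP] using hp
  rw [contour, finsum_eq_sum_of_support_subset (s := P), coeffZ_sum]
  swap
  · intro p hp
    refine h0 p fun h => hp ?_
    simp only [h, map_zero, mul_zero]
  have h1 : ∀ p : ℤ × ℤ, coeffZ 1 (HahnSeries.C (HahnSeries.single (p.2 - p.1 + 1) 1) *
      (symbol B p.2 : LSerX K) *
        HahnSeries.C (HahnSeries.C (normalPair K p.1 p.2 (vec K S) T))) =
      ((PowerSeries.mk fun m => (m.factorial : K)⁻¹ * entry (B ^ m) p.1 p.2 *
        normalPair K p.1 p.2 (vec K S) T : PowerSeries K) : LaurentSeries K) := by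
    intro p
    have h2 := coeffZ_single_mul (p.1 - p.2) (p.2 - p.1 + 1) (symbol B p.2 : LSerX K)
    rw [show p.1 - p.2 + (p.2 - p.1 + 1) = 1 by ring] at h2
    rw [coeffZ_mul_C, h2, coeffZ_coe, ← HahnSeries.ofPowerSeries_C, ← map_mul]
    congr 1
    ext m
    rw [PowerSeries.coeff_mul_C, PowerSeries.coeff_mk, PowerSeries.coeff_mk, symbol,
      PowerSeries.coeff_mk, HahnSeries.coeff_smul, smul_eq_mul, sub_eq_add_neg,
      HahnSeries.coeff_single_mul_add, one_mul]
    rfl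
  rw [Finset.sum_congr rfl fun p _ => h1 p, ← map_sum]
  congr 1
  ext m
  rw [map_sum, PowerSeries.coeff_mk, piCoeff, finsum_eq_sum_of_support_subset (s := P)]
  · exact Finset.sum_congr rfl fun p _ => by rw [PowerSeries.coeff_mk]
  · intro p hp
    refine h0 p fun h => hp ?_
    simp only [h, mul_zero]

theorem coe_ne_zero {f : SerX K} (hf : PowerSeries.constantCoeff f ≠ 0) : (f : LSerX K) ≠ 0 := by
  intro h
  have h1 : f = 0 := HahnSeries.ofPowerSeries_injective (h.trans (map_zero _).symm)
  exact hf (by rw [h1, map_zero])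

theorem zpow_neg_mul_div_zpow {F : Type*} [Field F] {y : F} (w : F) (hy : y ≠ 0) (i j : ℤ) :
    y ^ (-(j - i + 1)) * (y / w) ^ (j + 1) = y ^ i * w ^ (-1 - j) := by
  rw [div_zpow, div_eq_mul_inv, ← zpow_neg, ← mul_assoc, ← zpow_add₀ hy]
  congr 2 <;> ring

/-- The regularised vacuum expectation of a geometric progression of symbols `c (y/w)^{n+1}`. Its first
term has index `-1`, and the prefactor `y⁻¹ = z` turns the coefficient of `z^0` into the one of
`z`. -/
theorem vacuum_geometric {F : Type*} [Field F] {y w c : F} (hy : y ≠ 0) (hc : c ≠ 0) :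
    y ^ (-1 : ℤ) * (c * (y / w) ^ (-1 + 1 : ℤ) *
      (1 - c * (y / w) ^ (-2 + 1 : ℤ) / (c * (y / w) ^ (-1 + 1 : ℤ)))⁻¹) = c * (y - w)⁻¹ := by
  have e4 : 1 - c * (y / w) ^ (-2 + 1 : ℤ) / (c * (y / w) ^ (-1 + 1 : ℤ)) = (y - w) / y := by
    norm_num
    field_simp
  rw [e4, inv_div, neg_add_cancel, zpow_zero, mul_one, zpow_neg_one]
  field_simp

/-- The comparison for an operator whose symbols are `c (y/w)^{n+1}`: both sides are the contour
integral of `c ψ(y) ψ^*(w)`. -/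
theorem expCoeff_eq_of_symbol [CharZero K] {B : Module.End K (Ser K)} {y w c : LSerX K}
    (hy : y ≠ 0) (hw : w ≠ 0) (hyw : y ≠ w) (hc : c ≠ 0)
    (hz : ∀ n : ℤ, (HahnSeries.C (HahnSeries.single n 1) : LSerX K) = y ^ (-n))
    (hsym : ∀ n : ℤ, (symbol B n : LSerX K) = c * (y / w) ^ (n + 1)) (T S : Maya) :
    expCoeff B T S = contour (c * ((y / w) ^ S.charge * (y - w)⁻¹ *
      normalExpCoeff (fun n => (w ^ (-n) - y ^ (-n)) / (n : LSerX K)) T S)) := by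
  classical
  have hbos := bosonization ((HahnSeries.C : Ser K →+* LSerX K).comp HahnSeries.C) hy hw hyw T S
  simp only [RingHom.comp_apply] at hbos
  rw [normalExpCoeff, ← hbos, mul_add, contour, coeffZ_add, expCoeff, coe_mk_piCoeff, contour,
    mul_finsum]
  congr 1
  · congr 1
    refine finsum_congr fun p => ?_
    rw [hsym, hz, ← mul_assoc c, ← zpow_neg_mul_div_zpow w hy]
    ring
  · rw [vec, Finsupp.single_apply]
    by_cases hTS : T = S
    · rw [if_pos hTS, if_pos hTS.symm, vacuumTerm, hsym, hsym, map_one, map_one, mul_one,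
        ← coeffZ_single_mul 0 1, zero_add, hz, vacuum_geometric hy hc]
    · rw [if_neg hTS, if_neg (Ne.symm hTS), map_zero, map_zero, mul_zero, mul_zero]
      rfl

theorem div_mul_mul_mul_eq {F : Type*} [Field F] (R d Φ q E : F) :
    R / d * Φ * q * E = Φ * R * (q * d⁻¹ * E) := by
  rw [div_eq_mul_inv]
  ring

variable [Algebra ℂ K]

theorem integrand_eq (u t s : K) (w ρ : SerX K) (T S : Maya) :
    integrand u t s w ρ T S = (phase u t s w : LSerX K) * (ρ : LSerX K) *
      ((((PowerSeries.C yVar : SerX K) : LSerX K) / (w : LSerX K)) ^ S.charge *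
        (((PowerSeries.C yVar : SerX K) : LSerX K) - (w : LSerX K))⁻¹ *
        normalExpCoeff (fun n => ((w : LSerX K) ^ (-n) -
          ((PowerSeries.C yVar : SerX K) : LSerX K) ^ (-n)) / (n : LSerX K)) T S) :=
  div_mul_mul_mul_eq ..

/-- The flow of the vector field `a d/dy` is not the identity. -/
theorem coe_yVar_ne_coe {u t s : K} (hu : u ≠ 0) (ht : t ≠ 0) (hs : s ≠ 0) {w : SerX K}
    (hw : transport (fieldA u t s) w = 0) :
    ((PowerSeries.C yVar : SerX K) : LSerX K) ≠ (w : LSerX K) := by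
  intro h
  have h1 : PowerSeries.C yVar = w := HahnSeries.ofPowerSeries_injective h
  rw [← h1, transport_C, dY_yVar, mul_one, map_neg, neg_eq_zero] at hw
  have h2 : fieldA u t s = 0 := PowerSeries.C_injective (hw.trans (map_zero _).symm)
  have h3 : (HahnSeries.C s : Ser K) ≠ 0 := fun h =>
    hs (HahnSeries.C_injective (h.trans (map_zero _).symm))
  exact mul_ne_zero h3 (mul_ne_zero yVar_ne_zero (geomA_ne_zero hu ht)) h2

variable [CharZero K]

/-- The symbols of `e^{x s D}` form the geometric progression with ratio `y/w` through the one of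
index `-1`. -/
theorem coe_symbol {u t s : K} (hu : u ≠ 0) (ht : t ≠ 0) (hs : s ≠ 0) {w ρ : SerX K}
    (h0 : PowerSeries.constantCoeff w = yVar) (hw : transport (fieldA u t s) w = 0)
    (hρ0 : PowerSeries.constantCoeff ρ = 1)
    (hρ : transport (fieldA u t s) ρ = PowerSeries.C (2⁻¹ * dY (fieldA u t s)) * ρ) (n : ℤ) :
    (symbol (s • opD u t s) n : LSerX K) = (phase u t s w : LSerX K) * (ρ : LSerX K) *
      (((PowerSeries.C yVar : SerX K) : LSerX K) / (w : LSerX K)) ^ (n + 1) := by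
  have hy : ((PowerSeries.C yVar : SerX K) : LSerX K) ≠ 0 :=
    coe_ne_zero (by rw [PowerSeries.constantCoeff_C]; exact yVar_ne_zero)
  have hw0 : (w : LSerX K) ≠ 0 := coe_ne_zero (by rw [h0]; exact yVar_ne_zero)
  have hstep : ∀ n : ℤ, ((PowerSeries.C yVar : SerX K) : LSerX K) *
      (symbol (s • opD u t s) (n - 1) : LSerX K) =
      (w : LSerX K) * (symbol (s • opD u t s) n : LSerX K) := by
    intro n
    rw [← map_mul, ← map_mul, symbol_pred hs h0 hw]
  have hq : ((PowerSeries.C yVar : SerX K) : LSerX K) / (w : LSerX K) ≠ 0 := div_ne_zero hy hw0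
  suffices h : ∀ m : ℤ, (symbol (s • opD u t s) (m - 1) : LSerX K) =
      (phase u t s w : LSerX K) * (ρ : LSerX K) *
      (((PowerSeries.C yVar : SerX K) : LSerX K) / (w : LSerX K)) ^ m by
    simpa using h (n + 1)
  intro m
  induction m using Int.induction_on with
  | zero =>
    rw [zero_sub, symbol_neg_one hu ht hs h0 hw hρ0 hρ, zpow_zero, mul_one, map_mul]
  | succ m ih =>
    have h1 := hstep m
    rw [ih] at h1
    rw [add_sub_cancel_right, zpow_add_one₀ hq, ← mul_assoc, mul_div_assoc', eq_div_iff hw0]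
    linear_combination -h1
  | pred m ih =>
    have h1 := hstep (-m - 1)
    rw [ih] at h1
    apply mul_left_cancel₀ hy
    rw [h1, zpow_sub_one₀ hq]
    field_simp

/-- The identity for the `w` and `ρ` given by transport along `d/dx - a d/dy`. -/
theorem expCoeff_eq_contour {u t s : K} (hu : u ≠ 0) (ht : t ≠ 0) (hs : s ≠ 0) {w ρ : SerX K}
    (h0 : PowerSeries.constantCoeff w = yVar) (hw : transport (fieldA u t s) w = 0)
    (hρ0 : PowerSeries.constantCoeff ρ = 1)
    (hρ : transport (fieldA u t s) ρ = PowerSeries.C (2⁻¹ * dY (fieldA u t s)) * ρ)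
    (T S : Maya) :
    expCoeff (s • opD u t s) T S = contour (integrand u t s w ρ T S) := by
  have hy : ((PowerSeries.C yVar : SerX K) : LSerX K) ≠ 0 :=
    coe_ne_zero (by rw [PowerSeries.constantCoeff_C]; exact yVar_ne_zero)
  have hw0 : (w : LSerX K) ≠ 0 := coe_ne_zero (by rw [h0]; exact yVar_ne_zero)
  have hΦ : (phase u t s w : LSerX K) ≠ 0 := coe_ne_zero (by
    rw [phase, constantCoeff_expX (phase_exponent_constantCoeff u t s h0)]
    exact one_ne_zero)
  have hρ' : (ρ : LSerX K) ≠ 0 := coe_ne_zero (by rw [hρ0]; exact one_ne_zero)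
  rw [integrand_eq, expCoeff_eq_of_symbol hy hw0 (coe_yVar_ne_coe hu ht hs hw)
    (mul_ne_zero hΦ hρ') C_single_eq_zpow (coe_symbol hu ht hs h0 hw hρ0 hρ)]

end Comparison

end BosonFermion

end

open BosonFermion in
theorem mainTheorem6 {K : Type*} [Field K] [Algebra ℂ K] (u t s : K)
    (hu : u ≠ 0) (ht : t ≠ 0) (hs : s ≠ 0) :
    (∃ r : LSerX K, r ≠ 1 ∧ ∀ n : ℤ,
      (symbol (s • opD u t s) (n - 1) : LSerX K) = r * (symbol (s • opD u t s) n : LSerX K)) ∧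
    ∃ w ρ : SerX K,
      (OnCurve u t s w ∧ ∀ w' : SerX K, OnCurve u t s w' → w' = w) ∧
      (IsSqrtDeriv w ρ ∧ ∀ ρ' : SerX K, IsSqrtDeriv w ρ' → ρ' = ρ) ∧
      ∀ T S : Maya,
        expCoeff (s • opD u t s) T S = contour (integrand u t s w ρ T S) := by
  have : CharZero K := charZero_of_injective_algebraMap (algebraMap ℂ K).injective
  obtain ⟨w, hw0, hw'⟩ := exists_transport (fieldA u t s) 0 yVar
  have hw : transport (fieldA u t s) w = 0 := by rw [hw', map_zero, zero_mul]
  obtain ⟨ρ, hρ0, hρ⟩ := exists_transport (fieldA u t s) (2⁻¹ * dY (fieldA u t s)) 1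
  have hcurve : OnCurve u t s w := .of_transport hu ht hw0 hw
  have hsqrt : IsSqrtDeriv w ρ := isSqrtDeriv_of_transport hw0 hw hρ0 hρ
  have hy : ((PowerSeries.C yVar : SerX K) : LSerX K) ≠ 0 :=
    coe_ne_zero (by rw [PowerSeries.constantCoeff_C]; exact yVar_ne_zero)
  refine ⟨⟨(w : LSerX K) / ((PowerSeries.C yVar : SerX K) : LSerX K), fun h => ?_, fun n => ?_⟩,
    w, ρ, ⟨hcurve, fun w' h => hcurve.unique hu ht h⟩, ⟨hsqrt, fun ρ' h => hsqrt.unique h⟩,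
    expCoeff_eq_contour hu ht hs hw0 hw hρ0 hρ⟩
  · exact coe_yVar_ne_coe hu ht hs hw ((div_eq_one_iff_eq hy).1 h).symm
  · rw [div_mul_eq_mul_div, eq_div_iff hy, mul_comm, ← map_mul, ← map_mul,
      symbol_pred hs hw0 hw]
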